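/- **Setting.** A weighted graph $G=(V,E,c)$ is a connected simple graph on $V=[n]$ with edge costs $c:E\to\mathbb R_{\ge 0}$ (graphs produced by the algorithm need not be connected). For $S\subseteq V$ let $\delta_G(S)=\sum_{uv\in E,\,u\in S,\,v\notin S}c_{uv}$. *Compilations.* Start from couplings $C_{uv}=0$ ($u\ne v$) and from the empty set $F$ of flipped vertices. A bit flip of $v$ changes the membership of $v$ in $F$; an $H_{\mathrm{Ising}}$ pulse of length $t>0$ and sign $\pm$ replaces every $C_{uv}$ by $C_{uv}\pm(-1)^{\mathbf 1_F(u)+\mathbf 1_F(v)}t$. A compilation of $G$ is a finite sequence of pulses and bit flips that ends with $F=\emptyset$ and $C_{uv}=c_{uv}$ for all $u\neq v$ (with $c_{uv}=0$ if $uv\notin E$). $N(H_{\mathrm{Ising}})(G)$ and $N(\mathrm{Total}_{\mathrm{Ops}})(G)$ are the minimum number of pulses and the minimum number of operations (pulses and bit flips) in a compilation of $G$. *Sparsification* $(G,\epsilon)$. Put $q=\lceil C_0 n\log n/\epsilon^2\rceil$ for a constant $C_0$. Choose $q$ edges of $G$ independently, each edge $e$ with probability $p_e$ proportional to $c_er_e$,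 where $r_e$ is the effective resistance between the endpoints of $e$ in the network with conductances $c$. Each time an edge $e$ is chosen, $c_e/(qp_e)$ is added to its weight in the output graph. (If all costs are $0$, the output has no edges.) *exp-decompose* $(H,\epsilon)$, where $H$ has costs $\bar c$ with maximum $c^*$. Put $\tau=\frac{\epsilon c^*}{2n^2}$ and $k=\lceil\log_{1+\epsilon/2}(c^*/\tau)\rceil$; for $j\in[k]$ let $H_j$ be the unweighted graph of the edges $e$ of $H$ with $\tau(1+\epsilon/2)^{j-1}<\bar c(e)\le\tau(1+\epsilon/2)^j$. Return $\sum_{j\in[k]}\tau(1+\epsilon/2)^{j-1}H_j$. *binary-decompose* $(H,\epsilon)$. Put $\eta=\frac{\epsilon c^*}{n^2}$ and $k=1+\lfloor\log_2(n^2/\epsilon)\rfloor$; for $j\in[k]$ let $H_j$ be the unweighted graph of the edges $e$ of $H$ for which the binary digit of $\lfloor\bar c(e)/\eta\rfloor$ at $2^{j-1}$ is $1$. Return $\sum_{j\in[k]}\eta2^{j-1}H_j$. *sparse-union-of-stars* $(G,\epsilon_1,\epsilon_2)$. Let $H$ be the output of sparsification on $(G,\epsilon_1)$; compute $G'_{\mathrm{bin}}$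 and $G'_{\mathrm{exp}}$ by binary-decompose and exp-decompose on $(H,\epsilon_2)$; return $G'=G'_{\mathrm{bin}}$ if $N(H_{\mathrm{Ising}})(G'_{\mathrm{bin}})<N(H_{\mathrm{Ising}})(G'_{\mathrm{exp}})$, and $G'=G'_{\mathrm{exp}}$ otherwise. **Theorem.** For every sufficiently large constant $C_0$ there are a constant $C$ and numbers $p_n\to1$, depending only on $C_0$, such that for every weighted graph $G=(V,E,c)$ on $n$ vertices and every $\epsilon\in(0,1)$, sparse-union-of-stars with $\epsilon_1=\epsilon_2=\epsilon/3$ returns a random graph $G'$ such that, with probability at least $p_n$, the costs of $G'$ are nonnegative and all of the following hold: 1. for all $S\subseteq V$ with $\delta_G(S)\ge\frac12\sum_{e\in E}c_e$, we have $(1-\epsilon)\,\delta_G(S)\le\delta_{G'}(S)\le(1+\epsilon)\,\delta_G(S)$; moreover every maximum cut $S$ of $G'$ satisfies $\delta_G(S)\ge(1-\epsilon)\max_{T\subseteq V}\delta_G(T)$; 2. $N(H_{\mathrm{Ising}})(G')\le C\,n\log\frac n\epsilon$; 3. $N(\mathrm{Total}_{\mathrm{Ops}})(G')\le C\,\dfrac{n\log(n/\epsilon)}{\epsilon^2}$.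 -/

import Mathlib

noncomputable section

/-- A weighted simple graph `(V, E, c)` on the vertex set `Fin n`; the edge cost function is
extended by `0` to the pairs that are not edges. -/
structure WGraph (n : ℕ) where
  graph : SimpleGraph (Fin n)
  cost : Sym2 (Fin n) → ℝ
  cost_of_notMem : ∀ e, e ∉ graph.edgeSet → cost e = 0

namespace WGraph

variable {n : ℕ}

def Nonneg (G : WGraph n) : Prop := ∀ e, 0 ≤ G.cost e

/-- The value of the cut `S`. -/
def cut (G : WGraph n) (S : Finset (Fin n)) : ℝ := ∑ u ∈ S, ∑ v ∈ Sᶜ, G.cost s(u, v)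

def totalCost (G : WGraph n) : ℝ := ∑ e : Sym2 (Fin n), G.cost e

/-- The largest edge cost (`0` if there is no edge). -/
def maxCost (G : WGraph n) : ℝ := sSup (G.cost '' G.graph.edgeSet)

def IsMaxCut (G : WGraph n) (S : Finset (Fin n)) : Prop := ∀ T, G.cut T ≤ G.cut S

open Classical in
/-- `∑_{j = 1}^{k} α j • F j` for unweighted graphs `F 1, …, F k`. -/
def weightedSum (k : ℕ) (α : ℕ → ℝ) (F : ℕ → SimpleGraph (Fin n)) : WGraph n where
  graph := SimpleGraph.fromEdgeSet (⋃ j ∈ Finset.Icc 1 k, (F j).edgeSet)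
  cost e := ∑ j ∈ Finset.Icc 1 k, if e ∈ (F j).edgeSet then α j else 0
  cost_of_notMem e he := by
    refine Finset.sum_eq_zero fun j hj => if_neg fun h => he ?_
    rw [SimpleGraph.edgeSet_fromEdgeSet]
    exact ⟨Set.mem_biUnion (Finset.mem_coe.2 hj) h, (F j).not_isDiag_of_mem_edgeSet h⟩

/-- The graph without edges. -/
def edgeless (n : ℕ) : WGraph n where
  graph := ⊥
  cost _ := 0
  cost_of_notMem _ _ := rfl

end WGraph

/-! ### Compilation by Ising pulses and bit flips -/

/-- An operation on `n` ions: a global Ising pulse of length `t > 0` and either sign, or a bit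
flip (Pauli `X`) of a single ion. -/
inductive IonOp (n : ℕ) where
  | pulse (positive : Bool) (t : ℝ) (ht : 0 < t) : IonOp n
  | flip (v : Fin n) : IonOp n

/-- The ions that are currently flipped, and the coefficients `C u v` of the products
`σᶻ_u σᶻ_v`, `u ≠ v`, that have been accumulated in the Hamiltonian. -/
@[ext]
structure IonState (n : ℕ) where
  flipped : Finset (Fin n)
  coupling : Fin n → Fin n → ℝ

namespace IonOp

variable {n : ℕ}

def step (s : IonState n) : IonOp n → IonState n
  | pulse positive t _ =>
    { flipped := s.flipped
      coupling := fun u v => s.coupling u v +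
        (if positive then 1 else -1) *
          ((-1) ^ ((if u ∈ s.flipped then 1 else 0) + (if v ∈ s.flipped then 1 else 0)) * t) }
  | flip v =>
    { flipped := if v ∈ s.flipped then s.flipped.erase v else insert v s.flipped
      coupling := s.coupling }

/-- The state after a sequence of operations, starting from the zero Hamiltonian. -/
def run (ops : List (IonOp n)) : IonState n :=
  ops.foldl step { flipped := ∅, coupling := fun _ _ => 0 }

def isPulse : IonOp n → Bool
  | pulse _ _ _ => true
  | flip _ => false

/-- `ops` is a graph compilation of `G`: it produces the couplings of `G`, and all bit flips have
been undone at the end (so that compilations can be concatenated). -/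
def Compiles (ops : List (IonOp n)) (G : WGraph n) : Prop :=
  (run ops).flipped = ∅ ∧ ∀ u v, u ≠ v → (run ops).coupling u v = G.cost s(u, v)

/-- `ops` adds `M` to the couplings. -/
def Adds (ops : List (IonOp n)) (M : Fin n → Fin n → ℝ) : Prop :=
  ∀ A : Fin n → Fin n → ℝ,
    ops.foldl step { flipped := ∅, coupling := A } = { flipped := ∅, coupling := A + M }

theorem exists_adds_pair (u v : Fin n) (h : u ≠ v) (c : ℝ) :
    ∃ ops, Adds ops (fun a b => if s(a, b) = s(u, v) then c else 0) := by
  rcases eq_or_ne c 0 with rfl | hc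
  · exact ⟨[], fun A => by ext <;> simp⟩
  have ht : 0 < |c| / 4 := by positivity
  have hs : (if decide (0 < c) = true then (1 : ℝ) else -1) * (|c| / 4) = c / 4 := by
    rcases lt_or_gt_of_ne hc with h0 | h0
    · simp only [not_lt.2 h0.le, decide_false, abs_of_neg h0]; norm_num; ring
    · simp [h0, abs_of_pos h0]
  have hs' : (if (!decide (0 < c)) = true then (1 : ℝ) else -1) * (|c| / 4) = -(c / 4) := by
    rcases lt_or_gt_of_ne hc with h0 | h0
    · simp only [not_lt.2 h0.le, decide_false, abs_of_neg h0]; norm_num; ring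
    · simp [h0, abs_of_pos h0]
  refine ⟨[pulse (decide (0 < c)) _ ht, flip u, pulse (!decide (0 < c)) _ ht, flip v,
    pulse (decide (0 < c)) _ ht, flip u, pulse (!decide (0 < c)) _ ht, flip v], fun A => ?_⟩
  have e1 : (insert v ({u} : Finset (Fin n))).erase u = {v} := by
    ext a; simp only [Finset.mem_erase, Finset.mem_insert, Finset.mem_singleton]; grind
  simp only [List.foldl, step, Finset.notMem_empty, if_false, insert_empty_eq,
    Finset.mem_singleton, h.symm, Finset.mem_insert, or_true, if_true, e1,
    Finset.erase_singleton, mul_left_comm _ ((-1 : ℝ) ^ (_ : ℕ)), hs, hs']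
  congr 1
  funext a b
  simp only [Pi.add_apply, Sym2.eq_iff]
  by_cases a1 : a = u <;> by_cases a2 : a = v <;> by_cases b1 : b = u <;> by_cases b2 : b = v <;>
    simp_all <;> ring

/-- Every weighted graph has a graph compilation. -/
theorem exists_compiles (G : WGraph n) : ∃ ops, Compiles ops G := by
  have key : ∀ s : Finset (Sym2 (Fin n)), (∀ e ∈ s, ¬ e.IsDiag) →
      ∃ ops, Adds ops (fun a b => if s(a, b) ∈ s then G.cost s(a, b) else 0) := by
    intro s
    induction s using Finset.induction_on with
    | empty => exact fun _ => ⟨[], fun A => by ext <;> simp⟩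
    | insert e s he ih =>
      intro hs
      obtain ⟨l, hl⟩ := ih fun f hf => hs f (Finset.mem_insert_of_mem hf)
      induction e using Sym2.ind with
      | _ u v =>
        obtain ⟨l', hl'⟩ := exists_adds_pair u v
          (by simpa using hs s(u, v) (Finset.mem_insert_self _ _)) (G.cost s(u, v))
        refine ⟨l ++ l', fun A => ?_⟩
        rw [List.foldl_append, hl, hl']
        congr 1
        funext a b
        simp only [Pi.add_apply, Finset.mem_insert]
        by_cases h1 : s(a, b) = s(u, v)
        · simp only [h1, he, if_true, if_false, true_or]; ring
        · simp [h1]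
  obtain ⟨ops, h⟩ := key (Finset.univ.filter fun e => ¬ e.IsDiag) (by simp)
  refine ⟨ops, ?_, fun u v huv => ?_⟩
  · rw [run, h]
  · rw [run, h]
    simp [huv]

end IonOp

namespace WGraph

variable {n : ℕ}

/-- `N(H_Ising)(G)`: the least number of pulses in a graph compilation of `G`. -/
def pulseNumber (G : WGraph n) : ℕ :=
  sInf ((fun ops => ops.countP IonOp.isPulse) '' {ops : List (IonOp n) | IonOp.Compiles ops G})

/-- `N(Total_Ops)(G)`: the least number of operations (pulses and bit flips) in a graph
compilation of `G`. -/
def totalOpsNumber (G : WGraph n) : ℕ :=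
  sInf (List.length '' {ops : List (IonOp n) | IonOp.Compiles ops G})

/-! ### The two decompositions -/

/-- The decomposition that groups the edges by the scale of their costs. -/
def expDecompose (G : WGraph n) (ε : ℝ) : WGraph n :=
  let τ := ε * G.maxCost / (2 * (n : ℝ) ^ 2)
  let k := ⌈Real.logb (1 + ε / 2) (G.maxCost / τ)⌉₊
  weightedSum k (fun j => τ * (1 + ε / 2) ^ (j - 1)) fun j =>
    SimpleGraph.fromEdgeSet {e ∈ G.graph.edgeSet |
      τ * (1 + ε / 2) ^ (j - 1) < G.cost e ∧ G.cost e ≤ τ * (1 + ε / 2) ^ j}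

/-- The decomposition by the binary digits of the rounded edge costs. -/
def binaryDecompose (G : WGraph n) (ε : ℝ) : WGraph n :=
  let η := ε * G.maxCost / (n : ℝ) ^ 2
  let k := 1 + ⌊Real.logb 2 ((n : ℝ) ^ 2 / ε)⌋₊
  weightedSum k (fun j => η * 2 ^ (j - 1)) fun j =>
    SimpleGraph.fromEdgeSet {e ∈ G.graph.edgeSet | ⌊G.cost e / η⌋₊.testBit (j - 1) = true}

/-- Whichever of the two decompositions needs fewer pulses. -/
def bestDecompose (G : WGraph n) (ε : ℝ) : WGraph n :=
  if (G.binaryDecompose ε).pulseNumber < (G.expDecompose ε).pulseNumber then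
    G.binaryDecompose ε
  else
    G.expDecompose ε

/-! ### Sparsification by effective resistances -/

/-- In the electrical network in which every edge `e` has conductance `cost e`, the vertex
potentials `φ` drive a unit current from `u` to `v` (Kirchhoff's law at every vertex `w`). -/
def IsUnitFlow (G : WGraph n) (u v : Fin n) (φ : Fin n → ℝ) : Prop :=
  ∀ w, ∑ x, G.cost s(w, x) * (φ w - φ x) = (if w = u then 1 else 0) - (if w = v then 1 else 0)

/-- `r` is the potential difference between the endpoints of `e` under a unit current from one to
the other. -/
def IsEffectiveResistance (G : WGraph n) (e : Sym2 (Fin n)) (r : ℝ) : Prop :=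
  ∃ u v φ, e = s(u, v) ∧ G.IsUnitFlow u v φ ∧ r = φ u - φ v

theorem IsUnitFlow.unique {G : WGraph n} {u v : Fin n} {φ ψ : Fin n → ℝ}
    (hφ : G.IsUnitFlow u v φ) (hψ : G.IsUnitFlow u v ψ) : φ u - φ v = ψ u - ψ v := by
  have h1 : ∀ α β : Fin n → ℝ, G.IsUnitFlow u v α →
      ∑ w, β w * ∑ x, G.cost s(w, x) * (α w - α x) = β u - β v := fun α β h => by
    rw [Finset.sum_congr rfl fun w _ => congrArg (β w * ·) (h w)]
    simp only [mul_sub, Finset.sum_sub_distrib, mul_ite, mul_one, mul_zero,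
      Finset.sum_ite_eq', Finset.mem_univ, if_true]
  have hsw : ∀ α β : Fin n → ℝ, ∑ w, ∑ x, G.cost s(w, x) * (β w * α x) =
      ∑ w, ∑ x, G.cost s(w, x) * (α w * β x) := fun α β => by
    rw [Finset.sum_comm]
    refine Finset.sum_congr rfl fun w _ => Finset.sum_congr rfl fun x _ => ?_
    rw [Sym2.eq_swap, mul_comm (β x)]
  have hx : ∀ α β : Fin n → ℝ, ∑ w, β w * ∑ x, G.cost s(w, x) * (α w - α x) =
      ∑ w, ∑ x, G.cost s(w, x) * (α w * β w) - ∑ w, ∑ x, G.cost s(w, x) * (β w * α x) :=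
    fun α β => by
      simp only [Finset.mul_sum, ← Finset.sum_sub_distrib]
      refine Finset.sum_congr rfl fun w _ => Finset.sum_congr rfl fun x _ => ?_
      ring
  rw [← h1 ψ φ hψ, ← h1 φ ψ hφ, hx, hx, hsw ψ φ]
  simp only [mul_comm (ψ _) (φ _)]

theorem IsUnitFlow.neg {G : WGraph n} {u v : Fin n} {φ : Fin n → ℝ}
    (hφ : G.IsUnitFlow u v φ) : G.IsUnitFlow v u (-φ) := fun w => by
  have h : ∑ x, G.cost s(w, x) * ((-φ) w - (-φ) x) = -∑ x, G.cost s(w, x) * (φ w - φ x) := by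
    rw [← Finset.sum_neg_distrib]
    exact Finset.sum_congr rfl fun x _ => by simp only [Pi.neg_apply]; ring
  rw [h, hφ w]
  ring

theorem IsEffectiveResistance.unique {G : WGraph n} {e : Sym2 (Fin n)} {r r' : ℝ}
    (h : G.IsEffectiveResistance e r) (h' : G.IsEffectiveResistance e r') : r = r' := by
  obtain ⟨u, v, φ, rfl, hφ, rfl⟩ := h
  obtain ⟨u', v', ψ, huv, hψ, rfl⟩ := h'
  rcases Sym2.eq_iff.1 huv with ⟨rfl, rfl⟩ | ⟨rfl, rfl⟩
  · exact hφ.unique hψ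
  · rw [hφ.unique hψ.neg]
    simp only [Pi.neg_apply]
    ring

open Classical in
/-- The effective resistance of `e`. If the costs are nonnegative, a value exists for every edge of
positive cost; the value `0` is used for pairs that are not joined by edges of positive cost. -/
def effectiveResistance (G : WGraph n) (e : Sym2 (Fin n)) : ℝ :=
  if h : ∃ r, G.IsEffectiveResistance e r then h.choose else 0

/-- The number to which the sampling probability of `e` is proportional. -/
def leverage (G : WGraph n) (e : Sym2 (Fin n)) : ENNReal :=
  ENNReal.ofReal (G.cost e * G.effectiveResistance e)

/-- The distribution of a random edge chosen with probability proportional to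
`cost e * effectiveResistance e`. -/
def edgeDist (G : WGraph n) (h : ∑' e, G.leverage e ≠ 0) : PMF (Sym2 (Fin n)) :=
  PMF.normalize G.leverage h (by
    rw [tsum_fintype]
    exact ENNReal.sum_ne_top.2 fun _ _ => ENNReal.ofReal_ne_top)

/-- The distribution of `q` independent samples from `p`. -/
def iidDist {α : Type*} [Fintype α] (p : PMF α) (q : ℕ) : PMF (Fin q → α) :=
  PMF.ofFintype (fun ω => ∏ t, p (ω t)) (by
    classical
    have h : ∑ a, p a = 1 := (tsum_fintype _).symm.trans p.tsum_coe
    rw [← Fintype.prod_sum]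
    simp [h])

open Classical in
/-- The graph built from the samples `ω`: each sample of an edge `e` adds `cost e / (q * p e)` to
the weight of `e`. -/
def sampledGraph (G : WGraph n) (p : PMF (Sym2 (Fin n))) {q : ℕ} (ω : Fin q → Sym2 (Fin n)) :
    WGraph n where
  graph := SimpleGraph.fromEdgeSet (G.graph.edgeSet ∩ Set.range ω)
  cost e := ∑ t, if ω t = e then G.cost e / (q * (p e).toReal) else 0
  cost_of_notMem e he := by
    refine Finset.sum_eq_zero fun t _ => ?_
    split_ifs with h
    · rw [G.cost_of_notMem e fun h' => he ?_, zero_div]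
      rw [SimpleGraph.edgeSet_fromEdgeSet]
      exact ⟨⟨h', t, h⟩, G.graph.not_isDiag_of_mem_edgeSet h'⟩
    · rfl

open Classical in
/-- Sparsification of `G` by `q = ⌈C₀ n log n / ε²⌉` independent samples; if all costs are zero,
so that there is nothing to sample, the result is the graph without edges. -/
def sparsify (C₀ : ℝ) (G : WGraph n) (ε : ℝ) : PMF (WGraph n) :=
  if h : ∑' e, G.leverage e ≠ 0 then
    (iidDist (G.edgeDist h) ⌈C₀ * n * Real.log n / ε ^ 2⌉₊).map (G.sampledGraph (G.edgeDist h))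
  else
    PMF.pure (edgeless n)

/-- The distribution of the graph returned by the algorithm: sparsify with error `ε₁`, then apply
the better of the two decompositions with error `ε₂`. -/
def sparseUnionOfStars (C₀ : ℝ) (G : WGraph n) (ε₁ ε₂ : ℝ) : PMF (WGraph n) :=
  (G.sparsify C₀ ε₁).map fun H => H.bestDecompose ε₂

end WGraph

end

/-! Only cuts carrying at least half of the total cost `W` have to be preserved, so an additive
error of order `ε * W`, uniform over all cuts, is enough. This replaces spectral sparsification by
an elementary Chernoff and union bound argument (`iidProb_cut_error_le`).

Two facts about effective resistances enter. The numbers `c e * r e` sum to at most `n`, and `r e`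
is at least the inverse of the weighted degree of either endpoint. Hence `p e ≥ c e / (n * deg u)`
for both endpoints `u` (`cost_le_edgeDist`), and one sample of `e` contributes at most `n * deg u /
q` to a cut.

A plain union bound over `2 ^ n` cuts fails: edges at vertices of degree about `W` only give tails
that are a power of `n`. Edges are therefore grouped by the dyadic scale `W / 2 ^ i` of the smaller
of their two endpoint degrees. At scale `i` a sample is smaller by the factor `2 ^ i`, while the
degree sum `2 * W` leaves at most `2 ^ (i + 2)` vertices of such degree or larger, hence at most `2
^ 2 ^ (i + 2)` different restrictions of cuts. The gain in the exponent pays for the number of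
restrictions, with the logarithmic number of scales absorbed by `log n` in the sample size.

Both decompositions round every cost down, with a relative error plus an absolute error that is a
fraction `ε / n ^ 2` of the largest cost (`IsRounding`). Over the at most `n ^ 2` pairs of a cut
this costs `O(ε * W)`, and `IsRounding.cut_bounds` combines the errors. Maximum cuts transfer
because some cut always carries at least `W / 2`.

The two operation counts come from different compilations. For pulses, an unweighted graph is a
union of `n` stars, a star takes four pulses, and the binary decomposition has `O(log (n / ε))`
layers; the returned graph needs no more pulses than the binary one. For all operations, each edge
is compiled separately at constant cost, and there are at most as many edges as samples. -/

/-! ### Cuts as sums over edges -/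

section Cuts

variable {n : ℕ}

/-- The indicator of the edges that cross the cut `S`. -/
noncomputable def crossInd (S : Finset (Fin n)) : Sym2 (Fin n) → ℝ :=
  Sym2.lift ⟨fun u v => if (u ∈ S ↔ v ∈ S) then 0 else 1, fun u v => by simp only [iff_comm]⟩

theorem crossInd_mk (S : Finset (Fin n)) (u v : Fin n) :
    crossInd S s(u, v) = if (u ∈ S ↔ v ∈ S) then 0 else 1 := rfl

theorem crossInd_nonneg (S : Finset (Fin n)) (e : Sym2 (Fin n)) : 0 ≤ crossInd S e := by
  induction e using Sym2.ind with
  | _ u v => rw [crossInd_mk]; split_ifs <;> norm_num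

theorem crossInd_le_one (S : Finset (Fin n)) (e : Sym2 (Fin n)) : crossInd S e ≤ 1 := by
  induction e using Sym2.ind with
  | _ u v => rw [crossInd_mk]; split_ifs <;> norm_num

/-- Every crossing edge has exactly one orientation that leads from `S` to its complement. -/
theorem sum_cut_eq_sum_crossInd (g : Sym2 (Fin n) → ℝ) (S : Finset (Fin n)) :
    ∑ u ∈ S, ∑ v ∈ Sᶜ, g s(u, v) = ∑ e, crossInd S e * g e := by
  classical
  rw [← Finset.sum_product']
  have h : ∑ e, crossInd S e * g e = ∑ e ∈ Finset.univ.filter (fun e => crossInd S e = 1), g e := by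
    rw [Finset.sum_filter]
    refine Finset.sum_congr rfl fun e _ => ?_
    induction e using Sym2.ind with
    | _ u v => rw [crossInd_mk]; split_ifs <;> simp_all
  rw [h]
  refine Finset.sum_bij (fun x _ => s(x.1, x.2)) ?_ ?_ ?_ ?_
  · rintro ⟨u, v⟩ hx
    simp only [Finset.mem_product, Finset.mem_compl] at hx
    simp [crossInd_mk, hx.1, hx.2]
  · rintro ⟨u, v⟩ hx ⟨u', v'⟩ hx' he
    simp only [Finset.mem_product, Finset.mem_compl] at hx hx'
    rcases Sym2.eq_iff.1 he with ⟨h1, h2⟩ | ⟨h1, h2⟩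
    · exact Prod.ext h1 h2
    · simp only at h1 h2
      exact absurd (h1 ▸ hx.1) hx'.2
  · intro e he
    induction e using Sym2.ind with
    | _ u v =>
      simp only [Finset.mem_filter, Finset.mem_univ, true_and, crossInd_mk] at he
      by_cases hu : u ∈ S
      · exact ⟨(u, v), by simp_all, rfl⟩
      · exact ⟨(v, u), by simp_all, Sym2.eq_swap⟩
  · intros; rfl

namespace WGraph

theorem cut_eq_sum (G : WGraph n) (S : Finset (Fin n)) :
    G.cut S = ∑ e, crossInd S e * G.cost e :=
  sum_cut_eq_sum_crossInd G.cost S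

theorem cost_diag (G : WGraph n) (u : Fin n) : G.cost s(u, u) = 0 :=
  G.cost_of_notMem _ fun h => G.graph.not_isDiag_of_mem_edgeSet h (by simp)

theorem totalCost_nonneg {G : WGraph n} (hG : G.Nonneg) : 0 ≤ G.totalCost :=
  Finset.sum_nonneg fun e _ => hG e

theorem cut_nonneg {G : WGraph n} (hG : G.Nonneg) (S : Finset (Fin n)) : 0 ≤ G.cut S := by
  rw [cut_eq_sum]
  exact Finset.sum_nonneg fun e _ => mul_nonneg (crossInd_nonneg S e) (hG e)

theorem cut_le_totalCost {G : WGraph n} (hG : G.Nonneg) (S : Finset (Fin n)) :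
    G.cut S ≤ G.totalCost := by
  rw [cut_eq_sum]
  exact Finset.sum_le_sum fun e _ => mul_le_of_le_one_left (hG e) (crossInd_le_one S e)

/-- The sum of the costs of the edges at `u`. -/
noncomputable def wdeg (G : WGraph n) (u : Fin n) : ℝ := ∑ v, G.cost s(u, v)

theorem wdeg_eq_cut (G : WGraph n) (u : Fin n) : G.wdeg u = G.cut {u} := by
  classical
  rw [wdeg, cut, Finset.sum_singleton, ← Finset.sum_compl_add_sum {u}, Finset.sum_singleton,
    cost_diag, add_zero]

theorem wdeg_le_totalCost {G : WGraph n} (hG : G.Nonneg) (u : Fin n) :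
    G.wdeg u ≤ G.totalCost :=
  G.wdeg_eq_cut u ▸ cut_le_totalCost hG _

theorem cost_le_wdeg {G : WGraph n} (hG : G.Nonneg) (u v : Fin n) : G.cost s(u, v) ≤ G.wdeg u :=
  Finset.single_le_sum (f := fun v => G.cost s(u, v)) (fun _ _ => hG _) (Finset.mem_univ v)

/-- A sum over ordered pairs counts every edge twice. -/
theorem sum_sum_eq_two_mul_sum {g : Sym2 (Fin n) → ℝ} (hg : ∀ u, g s(u, u) = 0) :
    ∑ u, ∑ v, g s(u, v) = 2 * ∑ e, g e := by
  classical
  have h : ∀ u, ∑ v, g s(u, v) = ∑ e, crossInd {u} e * g e := fun u => by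
    rw [← sum_cut_eq_sum_crossInd, Finset.sum_singleton, ← Finset.sum_compl_add_sum {u},
      Finset.sum_singleton, hg, add_zero]
  simp only [h]
  rw [Finset.sum_comm, Finset.mul_sum]
  refine Finset.sum_congr rfl fun e _ => ?_
  rw [← Finset.sum_mul]
  induction e using Sym2.ind with
  | _ u v =>
    rcases eq_or_ne u v with rfl | huv
    · simp [hg]
    · congr 1
      -- An edge crosses exactly two singleton cuts, those of its endpoints.
      have : ∀ w : Fin n, crossInd {w} s(u, v) =
          (if w = u then 1 else 0) + (if w = v then 1 else 0) := fun w => by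
        rw [crossInd_mk]
        simp only [Finset.mem_singleton]
        by_cases h1 : w = u <;> by_cases h2 : w = v <;> simp_all [eq_comm]
      simp only [this, Finset.sum_add_distrib, Finset.sum_ite_eq', Finset.mem_univ, if_true]
      norm_num

theorem sum_wdeg (G : WGraph n) : ∑ u, G.wdeg u = 2 * G.totalCost :=
  sum_sum_eq_two_mul_sum G.cost_diag

/-- Moving `u` to the other side is an involution on the sets `S` that exchanges those separating
`u` from `v` with the others. -/
theorem sum_crossInd {u v : Fin n} (huv : u ≠ v) :
    ∑ S : Finset (Fin n), crossInd S s(u, v) = 2 ^ n / 2 := by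
  classical
  have h := Equiv.sum_comp (Function.Involutive.toPerm (fun S : Finset (Fin n) => symmDiff S {u})
    (fun S => by simp)) (fun S => crossInd S s(u, v))
  have h2 : ∀ S : Finset (Fin n), crossInd (symmDiff S {u}) s(u, v) = 1 - crossInd S s(u, v) := by
    intro S
    simp only [crossInd_mk, Finset.mem_symmDiff, Finset.mem_singleton]
    by_cases h1 : u ∈ S <;> by_cases h2 : v ∈ S <;> simp [h1, h2, huv.symm]
  change ∑ S : Finset (Fin n), crossInd (symmDiff S {u}) s(u, v) = ∑ S, crossInd S s(u, v) at h
  simp only [h2, Finset.sum_sub_distrib, Finset.sum_const,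
    Finset.card_univ, Fintype.card_finset, Fintype.card_fin, nsmul_eq_mul, mul_one] at h
  push_cast at h
  linarith

/-- Some cut has at least half of the total cost. -/
theorem exists_half_le_cut (G : WGraph n) : ∃ T, G.totalCost / 2 ≤ G.cut T := by
  classical
  -- A uniformly random set cuts each edge with probability `1 / 2`, so the average cut is half the
  -- total cost.
  have h : ∑ _S : Finset (Fin n), G.totalCost / 2 = ∑ S : Finset (Fin n), G.cut S := by
    simp only [cut_eq_sum]
    rw [Finset.sum_comm]
    simp only [← Finset.sum_mul, totalCost, Finset.sum_div, Finset.sum_const, nsmul_eq_mul,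
      Finset.mul_sum, Finset.card_univ, Fintype.card_finset, Fintype.card_fin]
    refine Finset.sum_congr rfl fun e _ => ?_
    induction e using Sym2.ind with
    | _ u v =>
      rcases eq_or_ne u v with rfl | huv
      · simp [cost_diag]
      · rw [sum_crossInd huv]; push_cast; ring
  obtain ⟨T, -, hT⟩ := Finset.exists_le_of_sum_le (Finset.univ_nonempty) h.le
  exact ⟨T, hT⟩

end WGraph

end Cuts

/-! ### Effective resistances -/

namespace WGraph

variable {n : ℕ}

/-- The weighted Laplacian. -/
noncomputable def laplacian (G : WGraph n) : Matrix (Fin n) (Fin n) ℝ :=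
  fun w x => (if w = x then G.wdeg w else 0) - G.cost s(w, x)

theorem laplacian_mulVec (G : WGraph n) (φ : Fin n → ℝ) (w : Fin n) :
    G.laplacian.mulVec φ w = ∑ x, G.cost s(w, x) * (φ w - φ x) := by
  simp only [Matrix.mulVec, dotProduct, laplacian, sub_mul, ite_mul, zero_mul,
    Finset.sum_sub_distrib, Finset.sum_ite_eq, Finset.mem_univ, if_true, wdeg, mul_sub,
    Finset.sum_mul]

theorem laplacian_isHermitian (G : WGraph n) : G.laplacian.IsHermitian := by
  ext w x
  simp only [Matrix.conjTranspose_apply, laplacian, star_trivial, Sym2.eq_swap (a := x)]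
  congr 1
  by_cases h : w = x
  · simp [h]
  · simp [h, Ne.symm h]

/-- The Dirichlet form of the network, as a sum over ordered pairs. -/
theorem two_mul_sum_mul_laplacian (G : WGraph n) (f g : Fin n → ℝ) :
    2 * ∑ w, f w * ∑ x, G.cost s(w, x) * (g w - g x) =
      ∑ w, ∑ x, G.cost s(w, x) * ((f w - f x) * (g w - g x)) := by
  have h : ∑ w, f w * ∑ x, G.cost s(w, x) * (g w - g x) =
      ∑ w, ∑ x, G.cost s(w, x) * (f w * (g w - g x)) := by
    simp only [Finset.mul_sum]
    exact Finset.sum_congr rfl fun w _ => Finset.sum_congr rfl fun x _ => by ring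
  have h' : ∑ w, f w * ∑ x, G.cost s(w, x) * (g w - g x) =
      ∑ w, ∑ x, G.cost s(w, x) * (f x * (g x - g w)) := by
    rw [h, Finset.sum_comm]
    exact Finset.sum_congr rfl fun w _ => Finset.sum_congr rfl fun x _ => by rw [Sym2.eq_swap]
  rw [two_mul]
  nth_rewrite 1 [h]
  rw [h', ← Finset.sum_add_distrib]
  refine Finset.sum_congr rfl fun w _ => ?_
  rw [← Finset.sum_add_distrib]
  exact Finset.sum_congr rfl fun x _ => by ring

/-- The Dirichlet energy of a harmonic `f` vanishes, and it is a sum of nonnegative terms, one for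
every ordered pair. -/
theorem eq_of_laplacian_eq_zero {G : WGraph n} (hG : G.Nonneg) {f : Fin n → ℝ}
    (hf : ∀ w, ∑ x, G.cost s(w, x) * (f w - f x) = 0) {u v : Fin n} (huv : 0 < G.cost s(u, v)) :
    f u = f v := by
  have h := G.two_mul_sum_mul_laplacian f f
  simp only [hf, mul_zero, Finset.sum_const_zero] at h
  have hnn : ∀ w x, 0 ≤ G.cost s(w, x) * ((f w - f x) * (f w - f x)) := fun w x =>
    mul_nonneg (hG _) (mul_self_nonneg _)
  have h1 := (Finset.sum_eq_zero_iff_of_nonneg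
    fun w _ => Finset.sum_nonneg fun x _ => hnn w x).1 h.symm u (Finset.mem_univ u)
  have h2 := (Finset.sum_eq_zero_iff_of_nonneg fun x _ => hnn u x).1 h1 v (Finset.mem_univ v)
  rcases mul_eq_zero.1 h2 with h3 | h3
  · exact absurd h3 huv.ne'
  · exact sub_eq_zero.1 (mul_self_eq_zero.1 h3)

theorem effectiveResistance_eq {G : WGraph n} {u v : Fin n} {φ : Fin n → ℝ}
    (hφ : G.IsUnitFlow u v φ) : G.effectiveResistance s(u, v) = φ u - φ v := by
  have h : ∃ r, G.IsEffectiveResistance s(u, v) r := ⟨_, u, v, φ, rfl, hφ, rfl⟩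
  rw [effectiveResistance, dif_pos h]
  exact h.choose_spec.unique ⟨u, v, φ, rfl, hφ, rfl⟩

/-- The resistance of an edge is at least the inverse of the degree of an endpoint. -/
theorem IsUnitFlow.one_le_wdeg_mul {G : WGraph n} (hG : G.Nonneg) {u v : Fin n} (huv : u ≠ v)
    {φ : Fin n → ℝ} (hφ : G.IsUnitFlow u v φ) : 1 ≤ G.wdeg u * (φ u - φ v) := by
  have pair : ∀ f : Fin n → ℝ, ∑ w, f w * ∑ x, G.cost s(w, x) * (φ w - φ x) = f u - f v :=
    fun f => by
      rw [Finset.sum_congr rfl fun w _ => congrArg (f w * ·) (hφ w)]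
      simp only [mul_sub, Finset.sum_sub_distrib, mul_ite, mul_one, mul_zero,
        Finset.sum_ite_eq', Finset.mem_univ, if_true]
  -- Half of the Dirichlet energy of `φ - t • f`, where `f` is the indicator of `u`. The energy of
  -- `φ` gives the resistance, the mixed term gives `f u - f v = 1`, and the energy of `f` gives the
  -- degree. The best choice is `t = 1 / deg u`; degree `0` is contradictory for large `t`.
  have key : ∀ t : ℝ, 0 ≤ (φ u - φ v) - 2 * t + t ^ 2 * G.wdeg u := by
    intro t
    set f : Fin n → ℝ := Pi.single u 1 with hf
    have h1 := G.two_mul_sum_mul_laplacian φ φ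
    have h2 := G.two_mul_sum_mul_laplacian f φ
    have h3 := G.two_mul_sum_mul_laplacian f f
    rw [pair] at h1 h2
    have h4 : ∑ w, f w * ∑ x, G.cost s(w, x) * (f w - f x) = G.wdeg u := by
      rw [Finset.sum_eq_single u (fun w _ hw => by simp [hf, hw]) (by simp), wdeg]
      simp only [hf, Pi.single_eq_same, one_mul]
      refine Finset.sum_congr rfl fun x _ => ?_
      rcases eq_or_ne x u with rfl | hx
      · simp [cost_diag]
      · simp [hx]
    have h5 : f u - f v = 1 := by simp [hf, huv.symm]
    rw [h4] at h3
    rw [h5] at h2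
    have h6 : 0 ≤ ∑ w, ∑ x, G.cost s(w, x) * ((φ w - φ x) - t * (f w - f x)) ^ 2 :=
      Finset.sum_nonneg fun w _ => Finset.sum_nonneg fun x _ => mul_nonneg (hG _) (sq_nonneg _)
    have h7 : ∑ w, ∑ x, G.cost s(w, x) * ((φ w - φ x) - t * (f w - f x)) ^ 2 =
        ∑ w, ∑ x, G.cost s(w, x) * ((φ w - φ x) * (φ w - φ x)) -
        2 * t * ∑ w, ∑ x, G.cost s(w, x) * ((f w - f x) * (φ w - φ x)) +
        t ^ 2 * ∑ w, ∑ x, G.cost s(w, x) * ((f w - f x) * (f w - f x)) := by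
      simp only [Finset.mul_sum, ← Finset.sum_sub_distrib, ← Finset.sum_add_distrib]
      exact Finset.sum_congr rfl fun w _ => Finset.sum_congr rfl fun x _ => by ring
    rw [h7, ← h1, ← h2, ← h3] at h6
    linarith
  have h0 : 0 ≤ G.wdeg u := Finset.sum_nonneg fun x _ => hG _
  rcases h0.eq_or_lt with h0 | h0
  · have := key ((φ u - φ v) / 2 + 1)
    rw [← h0] at this
    linarith
  · have := mul_nonneg h0.le (key (1 / G.wdeg u))
    have h8 : G.wdeg u * (φ u - φ v - 2 * (1 / G.wdeg u) + (1 / G.wdeg u) ^ 2 * G.wdeg u) =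
        G.wdeg u * (φ u - φ v) - 1 := by field_simp; ring
    linarith

/-- The spectral formula for effective resistances, with the resulting bound on the sum of the
leverages. -/
theorem exists_isUnitFlow {G : WGraph n} (hG : G.Nonneg) :
    ∃ Φ : Fin n → Fin n → Fin n → ℝ,
      (∀ u v, 0 < G.cost s(u, v) → G.IsUnitFlow u v (Φ u v)) ∧
      ∑ u, ∑ v, G.cost s(u, v) * (Φ u v u - Φ u v v) ≤ 2 * n := by
  classical
  have hL := G.laplacian_isHermitian
  set b := hL.eigenvectorBasis with hb
  set μ := hL.eigenvalues with hμ
  have heig : ∀ i w, ∑ x, G.cost s(w, x) * (b i w - b i x) = μ i * b i w := fun i w => by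
    rw [← laplacian_mulVec G (fun w => b i w) w]
    have := congrFun (hL.mulVec_eigenvectorBasis i) w
    simpa using this
  have hnorm : ∀ i, ∑ w, b i w * b i w = 1 := fun i => by
    have h1 : inner ℝ (b i) (b i) = (1 : ℝ) := by
      rw [real_inner_self_eq_norm_sq, b.orthonormal.1 i, one_pow]
    rw [PiLp.inner_apply] at h1
    simpa only [RCLike.inner_apply, conj_trivial] using h1
  have hcompl : ∀ u w, ∑ i, b i u * b i w = if w = u then 1 else 0 := fun u w => by
    have h1 := b.sum_repr' (EuclideanSpace.single u (1 : ℝ))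
    have h2 := congrArg (fun z : EuclideanSpace ℝ (Fin n) => z w) h1
    simpa [PiLp.inner_apply, Pi.single_apply] using h2
  -- The pseudo-inverse of the Laplacian, in its eigenbasis, applied to the difference of the unit
  -- vectors at `u` and `v`.
  refine ⟨fun u v w => ∑ i, if μ i = 0 then 0 else (b i u - b i v) / μ i * b i w, ?_, ?_⟩
  · intro u v huv w
    have h1 : ∑ x, G.cost s(w, x) *
        ((∑ i, if μ i = 0 then 0 else (b i u - b i v) / μ i * b i w) -
          ∑ i, if μ i = 0 then 0 else (b i u - b i v) / μ i * b i x) =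
        ∑ i, (b i u - b i v) * b i w := by
      simp only [← Finset.sum_sub_distrib, Finset.mul_sum]
      rw [Finset.sum_comm]
      refine Finset.sum_congr rfl fun i _ => ?_
      by_cases hi : μ i = 0
      -- The omitted kernel terms vanish: a kernel vector takes equal values at the ends of an edge
      -- of positive cost. No connectivity is needed.
      · have : b i u = b i v := eq_of_laplacian_eq_zero hG (f := fun w => b i w)
          (fun w => by rw [heig, hi, zero_mul]) huv
        simp [hi, this]
      · simp only [hi, if_false]
        have h2 := heig i w
        calc _ = (b i u - b i v) / μ i * ∑ x, G.cost s(w, x) * (b i w - b i x) := by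
              rw [Finset.mul_sum]
              exact Finset.sum_congr rfl fun x _ => by ring
          _ = _ := by rw [h2]; field_simp
    rw [h1]
    simp only [sub_mul, Finset.sum_sub_distrib, hcompl]
  -- This is a trace: over ordered pairs, each nonzero eigenvalue contributes its normalized energy,
  -- exactly `2`.
  · have h1 : ∑ u, ∑ v, G.cost s(u, v) *
        ((∑ i, if μ i = 0 then 0 else (b i u - b i v) / μ i * b i u) -
          ∑ i, if μ i = 0 then 0 else (b i u - b i v) / μ i * b i v) =
        ∑ i, if μ i = 0 then 0 else 2 := by
      simp only [← Finset.sum_sub_distrib, Finset.mul_sum]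
      rw [Finset.sum_congr rfl fun u _ => Finset.sum_comm, Finset.sum_comm]
      refine Finset.sum_congr rfl fun i _ => ?_
      by_cases hi : μ i = 0
      · simp [hi]
      · simp only [hi, if_false]
        have h3 := G.two_mul_sum_mul_laplacian (fun w => b i w) (fun w => b i w)
        simp only [heig] at h3
        calc _ = (μ i)⁻¹ * ∑ u, ∑ v, G.cost s(u, v) *
              ((b i u - b i v) * (b i u - b i v)) := by
              simp only [Finset.mul_sum]
              exact Finset.sum_congr rfl fun u _ => Finset.sum_congr rfl fun v _ => by ring
          _ = (μ i)⁻¹ * (2 * (μ i * ∑ w, b i w * b i w)) := by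
              rw [← h3, Finset.mul_sum (f := fun w => b i w * b i w)]
              simp only [mul_left_comm (μ i)]
          _ = 2 := by rw [hnorm]; field_simp
    rw [h1]
    calc _ ≤ ∑ _i : Fin n, (2 : ℝ) := Finset.sum_le_sum fun i _ => by split_ifs <;> norm_num
      _ = 2 * n := by simp [mul_comm]

/-- The sum of `cost e * effectiveResistance e` is at most `n`. -/
theorem sum_cost_mul_effectiveResistance_le {G : WGraph n} (hG : G.Nonneg) :
    ∑ e, G.cost e * G.effectiveResistance e ≤ n := by
  obtain ⟨Φ, h1, h2⟩ := exists_isUnitFlow hG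
  have h3 := sum_sum_eq_two_mul_sum (g := fun e => G.cost e * G.effectiveResistance e)
    fun u => by rw [cost_diag, zero_mul]
  have h4 : ∑ u, ∑ v, G.cost s(u, v) * G.effectiveResistance s(u, v) =
      ∑ u, ∑ v, G.cost s(u, v) * (Φ u v u - Φ u v v) := by
    refine Finset.sum_congr rfl fun u _ => Finset.sum_congr rfl fun v _ => ?_
    rcases (hG s(u, v)).eq_or_lt with h | h
    · rw [← h, zero_mul, zero_mul]
    · rw [effectiveResistance_eq (h1 u v h)]
  rw [h4] at h3
  linarith

theorem one_le_wdeg_mul_effectiveResistance {G : WGraph n} (hG : G.Nonneg) {u v : Fin n}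
    (h : 0 < G.cost s(u, v)) : 1 ≤ G.wdeg u * G.effectiveResistance s(u, v) := by
  obtain ⟨Φ, h1, -⟩ := exists_isUnitFlow hG
  have huv : u ≠ v := by
    rintro rfl
    exact h.ne' (cost_diag G u)
  rw [effectiveResistance_eq (h1 u v h)]
  exact (h1 u v h).one_le_wdeg_mul hG huv

theorem cost_mul_effectiveResistance_nonneg {G : WGraph n} (hG : G.Nonneg) (e : Sym2 (Fin n)) :
    0 ≤ G.cost e * G.effectiveResistance e := by
  induction e using Sym2.ind with
  | _ u v =>
    rcases (hG s(u, v)).eq_or_lt with h | h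
    · rw [← h, zero_mul]
    · have h1 := one_le_wdeg_mul_effectiveResistance hG h
      have h2 : 0 < G.wdeg u := h.trans_le (cost_le_wdeg hG u v)
      exact mul_nonneg h.le (pos_of_mul_pos_right (zero_lt_one.trans_le h1) h2.le).le

theorem tsum_leverage {G : WGraph n} (hG : G.Nonneg) :
    ∑' e, G.leverage e = ENNReal.ofReal (∑ e, G.cost e * G.effectiveResistance e) := by
  rw [tsum_fintype, ENNReal.ofReal_sum_of_nonneg
    fun e _ => cost_mul_effectiveResistance_nonneg hG e]
  rfl

/-- An edge is sampled with probability at least `cost e / (n * wdeg u)`. -/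
theorem cost_le_edgeDist {G : WGraph n} (hG : G.Nonneg) (h : ∑' e, G.leverage e ≠ 0)
    (u v : Fin n) : G.cost s(u, v) ≤ n * G.wdeg u * (G.edgeDist h s(u, v)).toReal := by
  have h0 : 0 ≤ G.wdeg u := Finset.sum_nonneg fun x _ => hG _
  rcases (hG s(u, v)).eq_or_lt with hc | hc
  · rw [← hc]; positivity
  have hpos : 0 < ∑ e, G.cost e * G.effectiveResistance e := by
    rw [tsum_leverage hG] at h
    simpa using h
  have h1 : (G.edgeDist h s(u, v)).toReal = G.cost s(u, v) * G.effectiveResistance s(u, v) /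
      ∑ e, G.cost e * G.effectiveResistance e := by
    rw [edgeDist, PMF.normalize_apply, tsum_leverage hG, leverage, ENNReal.toReal_mul,
      ENNReal.toReal_inv, ENNReal.toReal_ofReal (cost_mul_effectiveResistance_nonneg hG _),
      ENNReal.toReal_ofReal hpos.le, div_eq_mul_inv]
  have h2 := sum_cost_mul_effectiveResistance_le hG
  have h3 := one_le_wdeg_mul_effectiveResistance hG hc
  rw [h1, mul_div_assoc', le_div_iff₀ hpos]
  calc _ ≤ G.cost s(u, v) * n := by gcongr
    _ ≤ G.cost s(u, v) * n * (G.wdeg u * G.effectiveResistance s(u, v)) :=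
        le_mul_of_one_le_right (by positivity) h3
    _ = _ := by ring

/-- Ensures that sampling is undefined only when all costs are zero. -/
theorem tsum_leverage_ne_zero {G : WGraph n} (hG : G.Nonneg) {e : Sym2 (Fin n)}
    (he : 0 < G.cost e) : ∑' e, G.leverage e ≠ 0 := by
  rw [tsum_leverage hG]
  induction e using Sym2.ind with
  | _ u v =>
    have h1 := one_le_wdeg_mul_effectiveResistance hG he
    have h2 : 0 < G.wdeg u := he.trans_le (cost_le_wdeg hG u v)
    have h3 := mul_pos he (pos_of_mul_pos_right (zero_lt_one.trans_le h1) h2.le)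
    have h4 := Finset.single_le_sum (f := fun e => G.cost e * G.effectiveResistance e)
      (fun e _ => cost_mul_effectiveResistance_nonneg hG e) (Finset.mem_univ s(u, v))
    exact (ENNReal.ofReal_pos.2 (h3.trans_le h4)).ne'

end WGraph

/-! ### Concentration of sums of independent samples -/

section Concentration

variable {α : Type*} [Fintype α]

/-- The probability of `B` under `q` independent samples with weights `p`. -/
noncomputable def iidProb (p : α → ℝ) {q : ℕ} (B : Set (Fin q → α)) : ℝ :=
  ∑ ω, B.indicator (fun ω => ∏ t, p (ω t)) ω

variable {p : α → ℝ} {q : ℕ}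

theorem iidProb_mono (hp : ∀ a, 0 ≤ p a) {A B : Set (Fin q → α)} (h : A ⊆ B) :
    iidProb p A ≤ iidProb p B :=
  Finset.sum_le_sum fun ω _ =>
    Set.indicator_le_indicator_of_subset h (fun ω => Finset.prod_nonneg fun t _ => hp (ω t)) ω

theorem iidProb_iUnion_le (hp : ∀ a, 0 ≤ p a) {ι : Type*} (s : Finset ι)
    (B : ι → Set (Fin q → α)) : iidProb p (⋃ i ∈ s, B i) ≤ ∑ i ∈ s, iidProb p (B i) := by
  classical
  simp only [iidProb]
  rw [Finset.sum_comm]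
  refine Finset.sum_le_sum fun ω _ => ?_
  have h0 : 0 ≤ ∏ t, p (ω t) := Finset.prod_nonneg fun t _ => hp (ω t)
  have h1 : ∀ i, 0 ≤ (B i).indicator (fun ω => ∏ t, p (ω t)) ω := fun i =>
    Set.indicator_apply_nonneg fun _ => h0
  by_cases h : ω ∈ ⋃ i ∈ s, B i
  · rw [Set.indicator_of_mem h]
    obtain ⟨i, hi, hω⟩ := Set.mem_iUnion₂.1 h
    refine le_trans ?_ (Finset.single_le_sum (fun i _ => h1 i) hi)
    rw [Set.indicator_of_mem hω]
  · rw [Set.indicator_of_notMem h]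
    exact Finset.sum_nonneg fun i _ => h1 i

theorem iidProb_compl (hp1 : ∑ a, p a = 1) (B : Set (Fin q → α)) :
    iidProb p Bᶜ = 1 - iidProb p B := by
  classical
  have h : ∑ ω : Fin q → α, ∏ t, p (ω t) = 1 := by
    rw [← Fintype.prod_sum]; simp [hp1]
  rw [eq_sub_iff_add_eq, iidProb, iidProb, ← Finset.sum_add_distrib, ← h]
  refine Finset.sum_congr rfl fun ω _ => ?_
  by_cases hω : ω ∈ B <;> simp [hω]

/-- The exponential Markov inequality. -/
theorem iidProb_exp_le (hp : ∀ a, 0 ≤ p a) (f : α → ℝ) (c : ℝ) :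
    iidProb p {ω : Fin q → α | c ≤ ∑ t, f (ω t)} ≤
      Real.exp (-c) * (∑ a, p a * Real.exp (f a)) ^ q := by
  classical
  have h : (∑ a, p a * Real.exp (f a)) ^ q =
      ∑ ω : Fin q → α, (∏ t, p (ω t)) * Real.exp (∑ t, f (ω t)) := by
    have h1 := Fintype.prod_sum (fun (_ : Fin q) a => p a * Real.exp (f a))
    rw [Finset.prod_const, Finset.card_univ, Fintype.card_fin] at h1
    rw [h1]
    exact Finset.sum_congr rfl fun ω _ => by rw [Finset.prod_mul_distrib, Real.exp_sum]
  rw [h, Finset.mul_sum]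
  refine Finset.sum_le_sum fun ω _ => ?_
  have h0 : 0 ≤ ∏ t, p (ω t) := Finset.prod_nonneg fun t _ => hp (ω t)
  refine Set.indicator_apply_le' (fun hω => ?_) (fun _ => by positivity)
  rw [mul_left_comm, ← Real.exp_add]
  refine le_mul_of_one_le_right h0 (Real.one_le_exp ?_)
  rw [Set.mem_ofPred_eq] at hω
  linarith

/-- Uses `exp x ≤ 1 + x + x ^ 2` for `|x| ≤ 1`, then `f ^ 2 ≤ b * f`, which bounds the second moment
by the mean. -/
theorem sum_mul_exp_le (hp : ∀ a, 0 ≤ p a) (hp1 : ∑ a, p a = 1) {f : α → ℝ} {b c : ℝ}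
    (hf : ∀ a, 0 ≤ f a) (hb : ∀ a, f a ≤ b) (hc : |c| * b ≤ 1) :
    ∑ a, p a * Real.exp (c * f a) ≤
      Real.exp (c * ∑ a, p a * f a + c ^ 2 * b * ∑ a, p a * f a) := by
  refine le_trans ?_ (Real.add_one_le_exp _)
  have h : ∀ a, p a * Real.exp (c * f a) ≤
      p a + c * (p a * f a) + c ^ 2 * b * (p a * f a) := fun a => by
    have h1 : |c * f a| ≤ 1 := by
      rw [abs_mul, abs_of_nonneg (hf a)]
      exact (mul_le_mul_of_nonneg_left (hb a) (abs_nonneg c)).trans hc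
    have h2 := (abs_le.1 (Real.abs_exp_sub_one_sub_id_le h1)).2
    have h3 : f a ^ 2 ≤ b * f a := by
      rw [sq]; exact mul_le_mul_of_nonneg_right (hb a) (hf a)
    have h4 : Real.exp (c * f a) ≤ 1 + c * f a + c ^ 2 * (b * f a) := by
      have := mul_le_mul_of_nonneg_left h3 (sq_nonneg c)
      nlinarith
    calc _ ≤ p a * (1 + c * f a + c ^ 2 * (b * f a)) := mul_le_mul_of_nonneg_left h4 (hp a)
      _ = _ := by ring
  refine (Finset.sum_le_sum fun a _ => h a).trans_eq ?_
  rw [Finset.sum_add_distrib, Finset.sum_add_distrib, hp1, Finset.mul_sum, Finset.mul_sum]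
  ring

/-- A Chernoff bound for sums of independent samples in `[0, b]`. -/
theorem iidProb_abs_sub_ge_le (hp : ∀ a, 0 ≤ p a) (hp1 : ∑ a, p a = 1) {f : α → ℝ}
    {b s M : ℝ} (hf : ∀ a, 0 ≤ f a) (hb : ∀ a, f a ≤ b) (hb0 : 0 < b)
    (hM : q * ∑ a, p a * f a ≤ M) (hs : 0 < s) (hsM : s ≤ M) :
    iidProb p {ω : Fin q → α | s ≤ |∑ t, f (ω t) - q * ∑ a, p a * f a|} ≤
      2 * Real.exp (-(s ^ 2 / (4 * b * M))) := by
  have hM0 : 0 < M := hs.trans_le hsM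
  set μ := ∑ a, p a * f a with hμ
  -- Minimizes `c ^ 2 * b * M - c * s`; the assumption `s ≤ M` keeps `c * b` at most `1 / 2`.
  set c := s / (2 * b * M) with hcdef
  have hc0 : 0 < c := by positivity
  have hcb : c * b ≤ 1 := by
    have : c * b = s / M / 2 := by rw [hcdef]; field_simp
    rw [this]
    have := (div_le_one hM0).2 hsM
    linarith
  have key : ∀ d : ℝ, |d| = c →
      iidProb p {ω : Fin q → α | c * s + d * (q * μ) ≤ ∑ t, d * f (ω t)} ≤
        Real.exp (-(s ^ 2 / (4 * b * M))) := by
    intro d hd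
    have hd2 : d ^ 2 = c ^ 2 := by rw [← sq_abs, hd]
    refine (iidProb_exp_le hp (fun a => d * f a) _).trans ?_
    have h1 := sum_mul_exp_le hp hp1 (c := d) hf hb (by rw [hd]; exact hcb)
    have h2 : 0 ≤ ∑ a, p a * Real.exp (d * f a) :=
      Finset.sum_nonneg fun a _ => mul_nonneg (hp a) (Real.exp_pos _).le
    refine (mul_le_mul_of_nonneg_left (pow_le_pow_left₀ h2 h1 q) (Real.exp_pos _).le).trans ?_
    rw [← Real.exp_nat_mul, ← Real.exp_add, Real.exp_le_exp, hd2]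
    have h3 : c ^ 2 * b * (q * μ) ≤ c ^ 2 * b * M := by gcongr
    have h4 : c ^ 2 * b * M - c * s = -(s ^ 2 / (4 * b * M)) := by
      rw [hcdef]; field_simp; ring
    rw [← hμ]
    linarith
  have hsub : {ω : Fin q → α | s ≤ |∑ t, f (ω t) - q * μ|} ⊆
      ⋃ d ∈ ({c, -c} : Finset ℝ), {ω | c * s + d * (q * μ) ≤ ∑ t, d * f (ω t)} := by
    intro ω hω
    simp only [Set.mem_iUnion, Finset.mem_insert, Finset.mem_singleton, Set.mem_ofPred_eq,
      exists_prop, exists_eq_or_imp, exists_eq_left, ← Finset.mul_sum] at hω ⊢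
    rcases le_abs.1 hω with h | h
    · left; nlinarith
    · right; nlinarith
  refine (iidProb_mono hp hsub).trans ((iidProb_iUnion_le hp _ _).trans ?_)
  rw [Finset.sum_pair (fun h => by linarith)]
  have h1 := key c (abs_of_pos hc0)
  have h2 := key (-c) (by rw [abs_neg, abs_of_pos hc0])
  linarith

end Concentration

/-! ### Sampling preserves all cuts up to a small fraction of the total cost -/

namespace WGraph

variable {n : ℕ}

open Classical in
/-- The scale of the degree of `v`: it is `i` if the degree is in
`(totalCost / 2 ^ (i + 1), totalCost / 2 ^ i]`, and `L` for all smaller degrees. -/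
noncomputable def degLevel (G : WGraph n) (L : ℕ) (v : Fin n) : ℕ :=
  Nat.find (p := fun i => G.totalCost / 2 ^ (i + 1) < G.wdeg v ∨ L ≤ i) ⟨L, Or.inr le_rfl⟩

theorem degLevel_le (G : WGraph n) (L : ℕ) (v : Fin n) : G.degLevel L v ≤ L := by
  classical
  exact Nat.find_min' _ (Or.inr le_rfl)

theorem lt_wdeg_of_degLevel_lt {G : WGraph n} {L : ℕ} {v : Fin n} (h : G.degLevel L v < L) :
    G.totalCost / 2 ^ (G.degLevel L v + 1) < G.wdeg v := by
  classical
  rcases Nat.find_spec (p := fun i => G.totalCost / 2 ^ (i + 1) < G.wdeg v ∨ L ≤ i)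
    ⟨L, Or.inr le_rfl⟩ with h1 | h1
  · exact h1
  · exact absurd h1 (not_le.2 h)

theorem wdeg_le_of_degLevel {G : WGraph n} (hG : G.Nonneg) (L : ℕ) (v : Fin n) :
    G.wdeg v ≤ G.totalCost / 2 ^ G.degLevel L v := by
  classical
  rcases Nat.eq_zero_or_pos (G.degLevel L v) with h | h
  · rw [h, pow_zero, div_one]
    exact wdeg_le_totalCost hG v
  · have h1 : G.degLevel L v - 1 < G.degLevel L v := by omega
    have h2 := Nat.find_min (p := fun i => G.totalCost / 2 ^ (i + 1) < G.wdeg v ∨ L ≤ i)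
      ⟨L, Or.inr le_rfl⟩ h1
    rw [not_or, not_lt, Nat.sub_add_cancel h] at h2
    exact h2.1

/-- Few vertices have large degree. -/
theorem card_degLevel_le {G : WGraph n} (hG : G.Nonneg) (hW : 0 < G.totalCost) {L : ℕ}
    (hL : n ≤ 2 ^ L) {i : ℕ} (hi : i ≤ L) :
    (Finset.univ.filter fun v => G.degLevel L v ≤ i).card ≤ 2 ^ (i + 2) := by
  rcases hi.eq_or_lt with rfl | hi
  · refine (Finset.card_le_univ _).trans ?_
    rw [Fintype.card_fin]
    exact hL.trans (Nat.pow_le_pow_right two_pos (by omega))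
  · have h1 : ∀ v ∈ Finset.univ.filter (fun v => G.degLevel L v ≤ i),
        G.totalCost / 2 ^ (i + 1) ≤ G.wdeg v := fun v hv => by
      have hv' := (Finset.mem_filter.1 hv).2
      refine le_trans ?_ (lt_wdeg_of_degLevel_lt (hv'.trans_lt hi)).le
      gcongr
      norm_num
    have h2 := Finset.card_nsmul_le_sum _ _ _ h1
    have h3 : ∑ v ∈ Finset.univ.filter (fun v => G.degLevel L v ≤ i), G.wdeg v ≤
        ∑ v, G.wdeg v := Finset.sum_le_sum_of_subset_of_nonneg (Finset.filter_subset _ _)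
      fun v _ _ => Finset.sum_nonneg fun x _ => hG _
    rw [sum_wdeg] at h3
    rw [nsmul_eq_mul, mul_div_assoc', div_le_iff₀ (by positivity)] at h2
    have h4 : ((Finset.univ.filter fun v => G.degLevel L v ≤ i).card : ℝ) * G.totalCost ≤
        2 ^ (i + 2) * G.totalCost := by
      calc _ ≤ _ := h2
        _ ≤ 2 * G.totalCost * 2 ^ (i + 1) := by gcongr
        _ = _ := by ring
    have h5 := le_of_mul_le_mul_right h4 hW
    exact_mod_cast h5

/-- The level of an edge is the larger one of the levels of its endpoints. -/
noncomputable def edgeLevel (G : WGraph n) (L : ℕ) : Sym2 (Fin n) → ℕ :=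
  Sym2.lift ⟨fun u v => max (G.degLevel L u) (G.degLevel L v), fun _ _ => max_comm _ _⟩

theorem edgeLevel_mk (G : WGraph n) (L : ℕ) (u v : Fin n) :
    G.edgeLevel L s(u, v) = max (G.degLevel L u) (G.degLevel L v) := rfl

theorem edgeLevel_le (G : WGraph n) (L : ℕ) (e : Sym2 (Fin n)) : G.edgeLevel L e ≤ L := by
  induction e using Sym2.ind with
  | _ u v => exact max_le (degLevel_le G L u) (degLevel_le G L v)

/-- Both endpoints have level at most `i`, so the trace of `S` on those vertices decides whether the
edge crosses. This reduces the cuts to be counted at level `i`. -/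
theorem crossInd_filter_degLevel (G : WGraph n) (L : ℕ) (S : Finset (Fin n)) {e : Sym2 (Fin n)}
    {i : ℕ} (he : G.edgeLevel L e = i) :
    crossInd (S.filter fun v => G.degLevel L v ≤ i) e = crossInd S e := by
  induction e using Sym2.ind with
  | _ u v =>
    rw [edgeLevel_mk] at he
    have hu : G.degLevel L u ≤ i := he ▸ le_max_left _ _
    have hv : G.degLevel L v ≤ i := he ▸ le_max_right _ _
    simp only [crossInd_mk, Finset.mem_filter, hu, hv, and_true]

/-- The endpoint attaining the level of the edge has degree at most `totalCost / 2 ^ level`, and the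
sampling bound is applied at that endpoint. -/
theorem cost_le_of_edgeLevel {G : WGraph n} (hG : G.Nonneg) {p : Sym2 (Fin n) → ℝ}
    (hp : ∀ e, 0 ≤ p e) (hpc : ∀ u v, G.cost s(u, v) ≤ n * G.wdeg u * p s(u, v)) (L : ℕ)
    (e : Sym2 (Fin n)) : G.cost e ≤ n * (G.totalCost / 2 ^ G.edgeLevel L e) * p e := by
  induction e using Sym2.ind with
  | _ u v =>
    rw [edgeLevel_mk]
    have h0 := hp s(u, v)
    rcases max_choice (G.degLevel L u) (G.degLevel L v) with h | h
    · rw [h]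
      refine (hpc u v).trans ?_
      gcongr
      exact wdeg_le_of_degLevel hG L u
    · rw [h]
      rw [Sym2.eq_swap] at h0 ⊢
      refine (hpc v u).trans ?_
      gcongr
      exact wdeg_le_of_degLevel hG L v

theorem clog_add_one_le (hn : 2 ≤ n) : (Nat.clog 2 n : ℝ) + 1 ≤ 5 * Real.log n := by
  have h1 : (2 : ℝ) ^ (Nat.clog 2 n - 1) ≤ n := by
    exact_mod_cast (Nat.pow_pred_clog_lt_self one_lt_two (by omega)).le
  have h2 : 1 ≤ Nat.clog 2 n := Nat.clog_pos one_lt_two hn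
  have h3 := Real.log_le_log (by positivity) h1
  rw [Real.log_pow, Nat.cast_sub h2, Nat.cast_one] at h3
  have h4 := Real.log_two_gt_d9
  have h5 : Real.log 2 ≤ Real.log n := Real.log_le_log two_pos (by exact_mod_cast hn)
  have h6 : (1 : ℝ) ≤ Nat.clog 2 n := by exact_mod_cast h2
  nlinarith

/-- With probability at least `1 - 10 / n`, the sampled weight of every cut differs from its cost
by at most `4 * γ * totalCost`. Edges are grouped by level; the number of relevant cuts of a level
is balanced by the smaller contributions of its edges. -/
theorem iidProb_cut_error_le {G : WGraph n} (hG : G.Nonneg) (hW : 0 < G.totalCost) (hn : 2 ≤ n)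
    {p : Sym2 (Fin n) → ℝ} (hp : ∀ e, 0 ≤ p e) (hp1 : ∑ e, p e = 1)
    (hpc : ∀ u v, G.cost s(u, v) ≤ n * G.wdeg u * p s(u, v)) {q : ℕ} {γ : ℝ} (hγ : 0 < γ)
    (hγ1 : γ ≤ 1) (hq : 60 * (n * Real.log n) ≤ γ ^ 2 * q) :
    iidProb p {ω : Fin q → Sym2 (Fin n) | ∃ S, 4 * γ * G.totalCost <
      |∑ t, crossInd S (ω t) * (G.cost (ω t) / (q * p (ω t))) - G.cut S|} ≤ 10 / n := by
  classical
  set W := G.totalCost with hWdef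
  set L := Nat.clog 2 n with hLdef
  have hn0 : (0 : ℝ) < n := by positivity
  have hlog : 0 < Real.log n := Real.log_pos (by exact_mod_cast hn)
  have hq0 : (0 : ℝ) < q := by
    have : 0 < γ ^ 2 * q := lt_of_lt_of_le (by positivity) hq
    exact pos_of_mul_pos_right this (by positivity)
  have hL : n ≤ 2 ^ L := Nat.le_pow_clog one_lt_two n
  set lev := G.edgeLevel L with hlev
  set z : Sym2 (Fin n) → ℝ := fun e => G.cost e / (q * p e) with hz
  set A : ℕ → Finset (Fin n) := fun i => Finset.univ.filter fun v => G.degLevel L v ≤ i with hA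
  set f : ℕ → Finset (Fin n) → Sym2 (Fin n) → ℝ := fun i T e =>
    if lev e = i then crossInd T e * z e else 0 with hf
  set g : ℕ → Finset (Fin n) → ℝ := fun i T =>
    ∑ e, if lev e = i then crossInd T e * G.cost e else 0 with hg
  -- `M i` bounds the mean at level `i`, padded twice: `W / (L + 1)` makes the exponent beat the
  -- number of cuts, and `W / 2 ^ i` adds a multiple of `log n`. The sum over all levels stays below
  -- `W + W + 2 * W`, the source of the factor `4`.
  set M : ℕ → ℝ := fun i =>
    (∑ e, if lev e = i then G.cost e else 0) + W / (L + 1) + W / 2 ^ i with hM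
  have hcost := cost_le_of_edgeLevel hG hp hpc L
  have hz0 : ∀ e, 0 ≤ z e := fun e => div_nonneg (hG e) (mul_nonneg hq0.le (hp e))
  have hpz : ∀ e, q * (p e * z e) = G.cost e := fun e => by
    -- Where `p e = 0`, the sampling bound forces the cost to be `0`, so division by zero does no
    -- harm.
    rcases (hp e).eq_or_lt with h | h
    · have h1 := hcost e
      rw [← h, mul_zero] at h1
      rw [← h, zero_mul, mul_zero, le_antisymm h1 (hG e)]
    · rw [hz]; field_simp
  have hzb : ∀ e, z e ≤ n * W / (2 ^ lev e * q) := fun e => by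
    rcases (hp e).eq_or_lt with h | h
    · rw [hz]; simp only [← h, mul_zero, div_zero]; positivity
    · rw [hz]
      simp only
      rw [div_le_div_iff₀ (by positivity) (by positivity)]
      have h1 := hcost e
      have h2 : (n : ℝ) * (W / 2 ^ lev e) * p e * (2 ^ lev e * q) = n * W * (q * p e) := by
        field_simp
      rw [← h2]
      gcongr
  have hf0 : ∀ i T e, 0 ≤ f i T e := fun i T e => by
    simp only [hf]; split_ifs
    · exact mul_nonneg (crossInd_nonneg T e) (hz0 e)
    · exact le_rfl
  have hfb : ∀ i T e, f i T e ≤ n * W / (2 ^ i * q) := fun i T e => by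
    simp only [hf]; split_ifs with h
    · rw [← h]
      exact (mul_le_of_le_one_left (hz0 e) (crossInd_le_one T e)).trans (hzb e)
    · positivity
  have hmean : ∀ i T, q * ∑ e, p e * f i T e = g i T := fun i T => by
    simp only [hg, hf, Finset.mul_sum]
    refine Finset.sum_congr rfl fun e _ => ?_
    split_ifs
    · rw [← hpz e]; ring
    · ring
  have hWi : ∀ i, 0 ≤ ∑ e, if lev e = i then G.cost e else 0 := fun i =>
    Finset.sum_nonneg fun e _ => by split_ifs; exacts [hG e, le_rfl]
  have hgM : ∀ i T, g i T ≤ M i := fun i T => by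
    have h1 : g i T ≤ ∑ e, if lev e = i then G.cost e else 0 := by
      refine Finset.sum_le_sum fun e _ => ?_
      split_ifs
      · exact mul_le_of_le_one_left (hG e) (crossInd_le_one T e)
      · exact le_rfl
    have h2 : 0 ≤ W / ((L : ℝ) + 1) + W / 2 ^ i := by positivity
    simp only [hM]
    linarith
  have hMlow : ∀ i, W / (L + 1) + W / 2 ^ i ≤ M i := fun i => by
    simp only [hM]
    linarith [hWi i]
  have hM0 : ∀ i, 0 < M i := fun i => lt_of_lt_of_le (by positivity) (hMlow i)
  have htail : ∀ i T, iidProb p {ω : Fin q → Sym2 (Fin n) |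
      γ * M i ≤ |∑ t, f i T (ω t) - g i T|} ≤
        2 * Real.exp (-(3 * 2 ^ i + 2 * Real.log n)) := fun i T => by
    have h1 := iidProb_abs_sub_ge_le (q := q) hp hp1 (hf0 i T) (hfb i T) (by positivity)
      ((hmean i T).trans_le (hgM i T)) (mul_pos hγ (hM0 i))
      (mul_le_of_le_one_left (hM0 i).le hγ1)
    rw [hmean] at h1
    refine h1.trans ?_
    gcongr
    have hM0i := hM0 i
    have h2 : (γ * M i) ^ 2 / (4 * (n * W / (2 ^ i * q)) * M i) =
        γ ^ 2 * q / (4 * n) * (2 ^ i * M i / W) := by field_simp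
    rw [h2]
    have h3 : 15 * Real.log n ≤ γ ^ 2 * q / (4 * n) := by
      rw [le_div_iff₀ (by positivity)]
      linarith
    -- The two paddings of `M i` give the two summands.
    have h4 : 2 ^ i / (5 * Real.log n) + 1 ≤ 2 ^ i * M i / W := by
      rw [le_div_iff₀ hW]
      calc (2 ^ i / (5 * Real.log n) + 1) * W ≤ (2 ^ i / (L + 1) + 1) * W := by
            gcongr
            exact clog_add_one_le hn
        _ = 2 ^ i * (W / (L + 1) + W / 2 ^ i) := by field_simp
        _ ≤ _ := by gcongr; exact hMlow i
    calc (3 : ℝ) * 2 ^ i + 2 * Real.log n ≤ 3 * 2 ^ i + 15 * Real.log n := by linarith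
      _ = 15 * Real.log n * (2 ^ i / (5 * Real.log n) + 1) := by field_simp; ring
      _ ≤ _ := by gcongr
  have hsumM : ∑ i ∈ Finset.range (L + 1), M i ≤ 4 * W := by
    simp only [hM, Finset.sum_add_distrib]
    have h1 : ∑ i ∈ Finset.range (L + 1), ∑ e, (if lev e = i then G.cost e else 0) = W := by
      rw [Finset.sum_comm, hWdef, totalCost]
      refine Finset.sum_congr rfl fun e _ => ?_
      rw [Finset.sum_ite_eq, if_pos (Finset.mem_range.2 (Nat.lt_succ_of_le (edgeLevel_le G L e)))]
    have h2 : ∑ _i ∈ Finset.range (L + 1), W / ((L : ℝ) + 1) = W := by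
      rw [Finset.sum_const, Finset.card_range, nsmul_eq_mul]
      push_cast
      field_simp
    have h3 : ∑ i ∈ Finset.range (L + 1), W / 2 ^ i ≤ W * 2 := by
      have := sum_geometric_two_le (L + 1)
      simp only [one_div, inv_pow] at this
      simp only [div_eq_mul_inv, ← Finset.mul_sum]
      exact mul_le_mul_of_nonneg_left this hW.le
    linarith
  have hsub : {ω : Fin q → Sym2 (Fin n) | ∃ S, 4 * γ * W <
      |∑ t, crossInd S (ω t) * (G.cost (ω t) / (q * p (ω t))) - G.cut S|} ⊆
      ⋃ i ∈ Finset.range (L + 1), ⋃ T ∈ (A i).powerset,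
        {ω | γ * M i ≤ |∑ t, f i T (ω t) - g i T|} := by
    rintro ω ⟨S, hS⟩
    by_contra hω
    simp only [Set.mem_iUnion, Set.mem_ofPred_eq, not_exists, not_le] at hω
    refine absurd hS (not_lt.2 ?_)
    have h1 : ∀ i ∈ Finset.range (L + 1), |∑ t, f i S (ω t) - g i S| ≤ γ * M i := fun i hi => by
      have h2 := hω i hi (S.filter fun v => G.degLevel L v ≤ i)
        (Finset.mem_powerset.2 fun v hv => by simp [hA, (Finset.mem_filter.1 hv).2])
      have h3 : ∀ e, f i (S.filter fun v => G.degLevel L v ≤ i) e = f i S e := fun e => by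
        simp only [hf]
        split_ifs with he
        · rw [crossInd_filter_degLevel G L S he]
        · rfl
      have h4 : g i (S.filter fun v => G.degLevel L v ≤ i) = g i S := by
        simp only [hg]
        refine Finset.sum_congr rfl fun e _ => ?_
        split_ifs with he
        · rw [crossInd_filter_degLevel G L S he]
        · rfl
      simp only [h3, h4] at h2
      exact h2.le
    have h5 : ∀ e, ∑ i ∈ Finset.range (L + 1), f i S e = crossInd S e * z e := fun e => by
      simp only [hf]
      rw [Finset.sum_ite_eq, if_pos (Finset.mem_range.2 (Nat.lt_succ_of_le (edgeLevel_le G L e)))]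
    have h6 : ∑ i ∈ Finset.range (L + 1), g i S = G.cut S := by
      simp only [hg]
      rw [Finset.sum_comm, cut_eq_sum]
      refine Finset.sum_congr rfl fun e _ => ?_
      rw [Finset.sum_ite_eq, if_pos (Finset.mem_range.2 (Nat.lt_succ_of_le (edgeLevel_le G L e)))]
    have h7 : ∑ t, crossInd S (ω t) * (G.cost (ω t) / (q * p (ω t))) - G.cut S =
        ∑ i ∈ Finset.range (L + 1), (∑ t, f i S (ω t) - g i S) := by
      rw [Finset.sum_sub_distrib, h6, Finset.sum_comm]
      simp only [h5, hz]
    rw [h7]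
    calc _ ≤ ∑ i ∈ Finset.range (L + 1), |∑ t, f i S (ω t) - g i S| :=
          Finset.abs_sum_le_sum_abs _ _
      _ ≤ ∑ i ∈ Finset.range (L + 1), γ * M i := Finset.sum_le_sum h1
      _ ≤ _ := by
          rw [← Finset.mul_sum]
          calc _ ≤ γ * (4 * W) := by gcongr
            _ = _ := by ring
  have hlevel : ∀ i ∈ Finset.range (L + 1), iidProb p (⋃ T ∈ (A i).powerset,
      {ω : Fin q → Sym2 (Fin n) | γ * M i ≤ |∑ t, f i T (ω t) - g i T|}) ≤ 2 / n ^ 2 := by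
    intro i hi
    refine (iidProb_iUnion_le hp _ _).trans ((Finset.sum_le_sum fun T _ => htail i T).trans ?_)
    rw [Finset.sum_const, Finset.card_powerset, nsmul_eq_mul]
    have h1 : (A i).card ≤ 2 ^ (i + 2) :=
      card_degLevel_le hG hW hL (Nat.lt_succ_iff.1 (Finset.mem_range.1 hi))
    -- The constant `3` in the tail exponent is chosen because `4 * log 2 < 3`.
    have h2 : ((2 ^ (A i).card : ℕ) : ℝ) ≤ Real.exp (3 * 2 ^ i) := by
      have h3 : (2 : ℝ) ^ (A i).card ≤ 2 ^ (2 ^ (i + 2)) := pow_le_pow_right₀ one_le_two h1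
      push_cast
      refine h3.trans ?_
      rw [← Real.exp_log (show (0 : ℝ) < 2 ^ 2 ^ (i + 2) by positivity), Real.exp_le_exp,
        Real.log_pow]
      push_cast
      have := Real.log_two_lt_d9
      calc (2 : ℝ) ^ (i + 2) * Real.log 2 = 4 * Real.log 2 * 2 ^ i := by ring
        _ ≤ _ := by gcongr; linarith
    calc _ ≤ Real.exp (3 * 2 ^ i) * (2 * Real.exp (-(3 * 2 ^ i + 2 * Real.log n))) := by gcongr
      _ = 2 * Real.exp (-(2 * Real.log n)) := by
          rw [mul_left_comm, ← Real.exp_add]; congr 2; ring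
      _ = 2 / n ^ 2 := by
          rw [Real.exp_neg, mul_comm 2 (Real.log n), Real.exp_mul, Real.exp_log hn0,
            div_eq_mul_inv]
          norm_cast
  refine (iidProb_mono hp hsub).trans ((iidProb_iUnion_le hp _ _).trans
    ((Finset.sum_le_sum hlevel).trans ?_))
  rw [Finset.sum_const, Finset.card_range, nsmul_eq_mul]
  push_cast
  have h1 := clog_add_one_le hn
  have h2 : Real.log n ≤ n := (Real.log_le_sub_one_of_pos hn0).trans (by linarith)
  calc ((L : ℝ) + 1) * (2 / n ^ 2) ≤ 5 * n * (2 / n ^ 2) := by gcongr; linarith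
    _ = 10 / (n : ℝ) := by field_simp; norm_num

end WGraph

/-! ### The decompositions round the costs -/

namespace WGraph

variable {n : ℕ}

/-- The costs of `H'` are those of `H`, rounded down with relative error `ε / 2` and absolute error
`ε * maxCost / n ^ 2`. -/
def IsRounding (H : WGraph n) (ε : ℝ) (H' : WGraph n) : Prop :=
  ∀ e, 0 ≤ H'.cost e ∧ H'.cost e ≤ H.cost e ∧
    H.cost e - ε / 2 * H.cost e - ε * H.maxCost / (n : ℝ) ^ 2 ≤ H'.cost e

theorem cost_le_maxCost (H : WGraph n) {e : Sym2 (Fin n)} (he : e ∈ H.graph.edgeSet) :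
    H.cost e ≤ H.maxCost :=
  le_csSup (Set.toFinite _).bddAbove (Set.mem_image_of_mem _ he)

theorem maxCost_le {H : WGraph n} {B : ℝ} (hB : 0 ≤ B) (h : ∀ e, H.cost e ≤ B) :
    H.maxCost ≤ B :=
  Real.sSup_le (by rintro _ ⟨e, -, rfl⟩; exact h e) hB

theorem maxCost_nonneg {H : WGraph n} (hH : H.Nonneg) : 0 ≤ H.maxCost :=
  Real.sSup_nonneg (by rintro _ ⟨e, -, rfl⟩; exact hH e)

theorem mem_edgeSet_fromEdgeSet_sep (H : WGraph n) (P : Sym2 (Fin n) → Prop) (e : Sym2 (Fin n)) :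
    e ∈ (SimpleGraph.fromEdgeSet {e ∈ H.graph.edgeSet | P e}).edgeSet ↔
      e ∈ H.graph.edgeSet ∧ P e := by
  rw [SimpleGraph.edgeSet_fromEdgeSet]
  exact ⟨fun h => h.1, fun h => ⟨h, H.graph.not_isDiag_of_mem_edgeSet h.1⟩⟩

open Classical in
theorem weightedSum_cost (k : ℕ) (α : ℕ → ℝ) (F : ℕ → SimpleGraph (Fin n)) (e : Sym2 (Fin n)) :
    (weightedSum k α F).cost e =
      ∑ j ∈ Finset.Icc 1 k, if e ∈ (F j).edgeSet then α j else 0 := rfl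

theorem sum_testBit (x k : ℕ) :
    ∑ j ∈ Finset.Icc 1 k, (if x.testBit (j - 1) = true then 2 ^ (j - 1) else 0) = x % 2 ^ k := by
  induction k with
  | zero => simp [Nat.mod_one]
  | succ k ih =>
    rw [Finset.sum_Icc_succ_top (by omega), ih, pow_succ, Nat.mod_mul, Nat.add_sub_cancel,
      Nat.testBit_eq_decide_div_mod_eq]
    rcases Nat.mod_two_eq_zero_or_one (x / 2 ^ k) with h | h <;> simp [h]

theorem isRounding_binaryDecompose {H : WGraph n} (hH : H.Nonneg) {ε : ℝ} (hε : 0 < ε) :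
    H.IsRounding ε (H.binaryDecompose ε) := by
  classical
  intro e
  have hmax := maxCost_nonneg hH
  by_cases he : e ∈ H.graph.edgeSet
  swap
  · have h0 : (H.binaryDecompose ε).cost e = 0 := by
      rw [binaryDecompose, weightedSum_cost]
      refine Finset.sum_eq_zero fun j _ => if_neg fun h => he ?_
      exact ((mem_edgeSet_fromEdgeSet_sep H _ e).1 h).1
    rw [h0, H.cost_of_notMem e he]
    have : 0 ≤ ε * H.maxCost / (n : ℝ) ^ 2 := by positivity
    exact ⟨le_rfl, le_rfl, by linarith⟩
  have hn : (0 : ℝ) < n := by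
    induction e using Sym2.ind with
    | _ u v => exact_mod_cast u.pos
  set η := ε * H.maxCost / (n : ℝ) ^ 2 with hη
  have hη0 : 0 ≤ η := by positivity
  set k := 1 + ⌊Real.logb 2 ((n : ℝ) ^ 2 / ε)⌋₊ with hk
  -- The rounded cost fits into `k` binary digits, so the layers lose nothing beyond the rounding.
  have hlt : ⌊H.cost e / η⌋₊ < 2 ^ k := by
    have h1 : H.cost e / η ≤ (n : ℝ) ^ 2 / ε := by
      rcases hmax.eq_or_lt with h | h
      · rw [hη, ← h, mul_zero, zero_div, div_zero]; positivity
      · have h2 := cost_le_maxCost H he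
        calc H.cost e / η ≤ H.maxCost / η := by gcongr
          _ = _ := by rw [hη]; field_simp
    have h2 : (n : ℝ) ^ 2 / ε < 2 ^ k := by
      have h3 := Nat.lt_floor_add_one (Real.logb 2 ((n : ℝ) ^ 2 / ε))
      rw [Real.logb_lt_iff_lt_rpow one_lt_two (by positivity)] at h3
      rw [hk, add_comm, ← Real.rpow_natCast]
      exact_mod_cast h3
    have h3 : ((⌊H.cost e / η⌋₊ : ℕ) : ℝ) < 2 ^ k :=
      ((Nat.floor_le (div_nonneg (hH e) hη0)).trans h1).trans_lt h2
    exact_mod_cast h3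
  have hcost : (H.binaryDecompose ε).cost e = η * ⌊H.cost e / η⌋₊ := by
    have h1 := sum_testBit ⌊H.cost e / η⌋₊ k
    rw [Nat.mod_eq_of_lt hlt] at h1
    conv_rhs => rw [← h1]
    push_cast
    rw [Finset.mul_sum, binaryDecompose, weightedSum_cost]
    refine Finset.sum_congr rfl fun j _ => ?_
    simp only [mem_edgeSet_fromEdgeSet_sep, he, true_and]
    split_ifs
    · rfl
    · rw [mul_zero]
  rw [hcost]
  have h0 := hH e
  refine ⟨by positivity, ?_, ?_⟩
  · rcases hη0.eq_or_lt with h | h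
    · rw [← h, zero_mul]; exact h0
    · calc _ ≤ η * (H.cost e / η) := by gcongr; exact Nat.floor_le (by positivity)
        _ = _ := by field_simp
  · have h3 : 0 ≤ ε / 2 * H.cost e := by positivity
    -- If `η = 0`, then the maximal cost, and hence the cost of `e`, is zero.
    rcases hη0.eq_or_lt with h | h
    · rw [← h, zero_mul]
      have h1 : H.maxCost = 0 := by
        rw [hη, eq_comm, div_eq_zero_iff, mul_eq_zero] at h
        rcases h with (h | h) | h
        · exact absurd h hε.ne'
        · exact h
        · exact absurd h (by positivity)
      have h2 := cost_le_maxCost H he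
      linarith
    · have h2 := Nat.lt_floor_add_one (H.cost e / η)
      rw [div_lt_iff₀ h] at h2
      linarith

theorem isRounding_expDecompose {H : WGraph n} (hH : H.Nonneg) {ε : ℝ} (hε : 0 < ε) :
    H.IsRounding ε (H.expDecompose ε) := by
  classical
  intro e
  have hmax := maxCost_nonneg hH
  have h0 := hH e
  set τ := ε * H.maxCost / (2 * (n : ℝ) ^ 2) with hτ
  set x := 1 + ε / 2 with hx
  set k := ⌈Real.logb x (H.maxCost / τ)⌉₊ with hk
  have hx1 : 1 < x := by rw [hx]; linarith
  have hx0 : 0 < x := by linarith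
  have hτ0 : 0 ≤ τ := by positivity
  have h2τ : 2 * τ = ε * H.maxCost / (n : ℝ) ^ 2 := by rw [hτ]; ring
  have hmono : ∀ {i j : ℕ}, i ≤ j → τ * x ^ i ≤ τ * x ^ j := fun h =>
    mul_le_mul_of_nonneg_left (pow_le_pow_right₀ hx1.le h) hτ0
  have hsum : (H.expDecompose ε).cost e = ∑ j ∈ Finset.Icc 1 k,
      if e ∈ H.graph.edgeSet ∧ τ * x ^ (j - 1) < H.cost e ∧ H.cost e ≤ τ * x ^ j
        then τ * x ^ (j - 1) else 0 := by
    rw [expDecompose, weightedSum_cost]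
    refine Finset.sum_congr rfl fun j _ => ?_
    simp only [mem_edgeSet_fromEdgeSet_sep]
    rfl
  rw [← h2τ]
  -- Costs up to `τ` are dropped and use the absolute error; larger ones lie in exactly one class
  -- and use the relative error.
  rcases le_or_gt (H.cost e) τ with hc | hc
  · have h1 : (H.expDecompose ε).cost e = 0 := by
      rw [hsum]
      refine Finset.sum_eq_zero fun j _ => if_neg fun h => ?_
      have := hmono (Nat.zero_le (j - 1))
      rw [pow_zero, mul_one] at this
      linarith [h.2.1]
    have h3 : 0 ≤ ε / 2 * H.cost e := by positivity
    rw [h1]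
    exact ⟨le_rfl, h0, by linarith⟩
  have hcpos : 0 < H.cost e := hτ0.trans_lt hc
  have he : e ∈ H.graph.edgeSet := by
    by_contra he
    exact hcpos.ne' (H.cost_of_notMem e he)
  have hn : (0 : ℝ) < n := by
    induction e using Sym2.ind with
    | _ u v => exact_mod_cast u.pos
  have hcmax := cost_le_maxCost H he
  have hτpos : 0 < τ := by
    have := hcpos.trans_le hcmax
    positivity
  set j := ⌈Real.logb x (H.cost e / τ)⌉₊ with hj
  have hq : 0 < H.cost e / τ := by positivity
  have hlog : 0 < Real.logb x (H.cost e / τ) :=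
    Real.logb_pos hx1 ((one_lt_div hτpos).2 hc)
  -- The strict inequality `τ < cost e` excludes class `0`.
  have hj1 : 1 ≤ j := Nat.ceil_pos.2 hlog
  have hjk : j ≤ k := by
    refine Nat.ceil_mono (Real.logb_le_logb_of_le hx1 hq ?_)
    gcongr
  have hup : H.cost e ≤ τ * x ^ j := by
    have h1 := Nat.le_ceil (Real.logb x (H.cost e / τ))
    rw [Real.logb_le_iff_le_rpow hx1 hq, Real.rpow_natCast, div_le_iff₀ hτpos] at h1
    rw [mul_comm]
    exact h1
  have hlow : τ * x ^ (j - 1) < H.cost e := by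
    have h1 : ((j - 1 : ℕ) : ℝ) < Real.logb x (H.cost e / τ) :=
      Nat.lt_ceil.1 (by omega)
    rw [Real.lt_logb_iff_rpow_lt hx1 hq, Real.rpow_natCast, lt_div_iff₀ hτpos] at h1
    rw [mul_comm]
    exact h1
  have hval : (H.expDecompose ε).cost e = τ * x ^ (j - 1) := by
    rw [hsum, Finset.sum_eq_single j, if_pos ⟨he, hlow, hup⟩]
    · intro i hi hij
      refine if_neg fun h => ?_
      rcases lt_or_gt_of_ne hij with h1 | h1
      · have := hmono (show i ≤ j - 1 by omega)
        linarith [h.2.2]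
      · have := hmono (show j ≤ i - 1 by omega)
        linarith [h.2.1]
    · exact fun h => absurd (Finset.mem_Icc.2 ⟨hj1, hjk⟩) h
  rw [hval]
  refine ⟨by positivity, hlow.le, ?_⟩
  have h1 : τ * x ^ j = τ * x ^ (j - 1) + ε / 2 * (τ * x ^ (j - 1)) := by
    obtain ⟨i, hi⟩ : ∃ i, j = i + 1 := ⟨j - 1, by omega⟩
    rw [hi, Nat.add_sub_cancel, pow_succ, hx]
    ring
  have h2 := mul_le_mul_of_nonneg_left hlow.le (half_pos hε).le
  linarith

theorem isRounding_bestDecompose {H : WGraph n} (hH : H.Nonneg) {ε : ℝ} (hε : 0 < ε) :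
    H.IsRounding ε (H.bestDecompose ε) := by
  rw [bestDecompose]
  split_ifs
  · exact isRounding_binaryDecompose hH hε
  · exact isRounding_expDecompose hH hε

theorem pulseNumber_bestDecompose_le (H : WGraph n) (ε : ℝ) :
    (H.bestDecompose ε).pulseNumber ≤ (H.binaryDecompose ε).pulseNumber := by
  rw [bestDecompose]
  split_ifs with h
  · exact le_rfl
  · exact not_lt.1 h

/-! ### Cuts of a rounded graph. -/

theorem IsRounding.cut_le {H H' : WGraph n} {ε : ℝ} (h : H.IsRounding ε H')
    (S : Finset (Fin n)) : H'.cut S ≤ H.cut S := by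
  rw [cut_eq_sum, cut_eq_sum]
  exact Finset.sum_le_sum fun e _ => mul_le_mul_of_nonneg_left (h e).2.1 (crossInd_nonneg S e)

/-- The absolute errors of the at most `n ^ 2` pairs across the cut add up to at most `ε * maxCost`.
-/
theorem IsRounding.le_cut {H H' : WGraph n} (hH : H.Nonneg) {ε : ℝ} (hε : 0 < ε)
    (h : H.IsRounding ε H') (S : Finset (Fin n)) :
    H.cut S - ε / 2 * H.cut S - ε * H.maxCost ≤ H'.cut S := by
  have hmax := maxCost_nonneg hH
  have h1 : ∑ u ∈ S, ∑ v ∈ Sᶜ, (H.cost s(u, v) - ε / 2 * H.cost s(u, v) -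
      ε * H.maxCost / (n : ℝ) ^ 2) ≤ H'.cut S :=
    Finset.sum_le_sum fun u _ => Finset.sum_le_sum fun v _ => (h s(u, v)).2.2
  simp only [Finset.sum_sub_distrib, ← Finset.mul_sum, Finset.sum_const, nsmul_eq_mul] at h1
  refine le_trans ?_ h1
  have h2 : (S.card : ℝ) * ((Sᶜ.card : ℝ) * (ε * H.maxCost / (n : ℝ) ^ 2)) ≤ ε * H.maxCost := by
    have h3 : (S.card : ℝ) ≤ n := by exact_mod_cast card_finset_fin_le S
    have h4 : (Sᶜ.card : ℝ) ≤ n := by exact_mod_cast card_finset_fin_le Sᶜ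
    calc _ ≤ (n : ℝ) * (n * (ε * H.maxCost / (n : ℝ) ^ 2)) := by gcongr
      _ ≤ ε * H.maxCost := by
        rcases Nat.eq_zero_or_pos n with h0 | h0
        · simp only [h0, Nat.cast_zero, zero_mul]; positivity
        · have : (0 : ℝ) < n := by exact_mod_cast h0
          apply le_of_eq; field_simp
  change H.cut S - ε / 2 * H.cut S - ε * H.maxCost ≤ H.cut S - ε / 2 * H.cut S - _
  linarith

/-- If all cuts of `H` are close to those of `G`, a rounding of `H` preserves the large cuts of `G`
and its maximum cuts are nearly maximum cuts of `G`. -/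
theorem IsRounding.cut_bounds {G H H' : WGraph n} (hG : G.Nonneg) (hH : H.Nonneg) {ε : ℝ}
    (hε : 0 < ε) (hε1 : ε < 1) (h : H.IsRounding (ε / 3) H')
    (hGH : ∀ S, |H.cut S - G.cut S| ≤ ε / 100 * G.totalCost) :
    (∀ S, G.totalCost / 2 ≤ G.cut S →
      (1 - ε) * G.cut S ≤ H'.cut S ∧ H'.cut S ≤ (1 + ε) * G.cut S) ∧
    (∀ S, H'.IsMaxCut S → ∀ T, (1 - ε) * G.cut T ≤ G.cut S) := by
  set W := G.totalCost with hW
  have hW0 : 0 ≤ W := totalCost_nonneg hG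
  have hεW : ε * W ≤ W := mul_le_of_le_one_left hW0 hε1.le
  -- An edge cost of `H` is at most the singleton cut at an endpoint, which is close to that of `G`.
  have hmax : H.maxCost ≤ 101 / 100 * W := by
    refine maxCost_le (by positivity) fun e => ?_
    induction e using Sym2.ind with
    | _ u v =>
      have h1 := (abs_le.1 (hGH {u})).2
      have h2 := cost_le_wdeg hH u v
      rw [wdeg_eq_cut] at h2
      have h3 := cut_le_totalCost hG {u}
      linarith
  -- With `W ≤ 2 * G.cut S`, the losses relative to `ε * G.cut S` are about `0.02` from sampling,
  -- `0.17` from relative and `0.67` from absolute rounding. Staying below `9 / 10` leaves room for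
  -- the sampling error in the maximum-cut claim.
  have hlow : ∀ S, W / 2 ≤ G.cut S → G.cut S - 9 / 10 * (ε * G.cut S) ≤ H'.cut S := fun S hS => by
    have h1 := h.le_cut hH (by positivity) S
    have h2 := abs_le.1 (hGH S)
    have hεS : ε * (W / 2) ≤ ε * G.cut S := mul_le_mul_of_nonneg_left hS hε.le
    have hεS' : ε * G.cut S ≤ G.cut S := mul_le_of_le_one_left (cut_nonneg hG S) hε1.le
    have h3 : H.cut S ≤ 102 / 100 * G.cut S := by linarith [h2.2]
    have h4 := mul_le_mul_of_nonneg_left h3 hε.le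
    have h5 := mul_le_mul_of_nonneg_left hmax hε.le
    linarith [h2.1]
  refine ⟨fun S hS => ⟨?_, ?_⟩, fun S hS T => ?_⟩
  · have := hlow S hS
    have h0 : 0 ≤ ε * G.cut S := mul_nonneg hε.le (cut_nonneg hG S)
    linarith
  · have h1 := h.cut_le S
    have h2 := (abs_le.1 (hGH S)).2
    have hεS : ε * (W / 2) ≤ ε * G.cut S := mul_le_mul_of_nonneg_left hS hε.le
    have h0 : 0 ≤ ε * G.cut S := mul_nonneg hε.le (cut_nonneg hG S)
    linarith
  · obtain ⟨T₀, hT₀⟩ := G.exists_half_le_cut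
    have key : ∀ T, W / 2 ≤ G.cut T → (1 - ε) * G.cut T ≤ G.cut S := fun T hT => by
      have h1 := h.cut_le S
      have h2 := (abs_le.1 (hGH S)).2
      have h3 := hlow T hT
      have h4 := hS T
      have hεT : ε * (W / 2) ≤ ε * G.cut T := mul_le_mul_of_nonneg_left hT hε.le
      have h0 : 0 ≤ ε * G.cut T := mul_nonneg hε.le (cut_nonneg hG T)
      linarith
    rcases le_total (W / 2) (G.cut T) with hT | hT
    · exact key T hT
    -- A cut below half of the total cost is dominated by `T₀`.
    · refine le_trans ?_ (key T₀ hT₀)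
      exact mul_le_mul_of_nonneg_left (hT.trans hT₀) (by linarith)

end WGraph

/-! ### Compilation by stars -/

namespace IonOp

variable {n : ℕ}

/-- The sign by which the flips of `F` act on ion `a`. -/
noncomputable def flipSign (F : Finset (Fin n)) (a : Fin n) : ℝ := if a ∈ F then -1 else 1

/-- The couplings `M` can be added with at most `a` pulses and at most `l` operations. -/
def AddsWithin (M : Fin n → Fin n → ℝ) (a l : ℕ) : Prop :=
  ∃ ops, Adds ops M ∧ ops.countP isPulse ≤ a ∧ ops.length ≤ l

theorem addsWithin_zero : AddsWithin (0 : Fin n → Fin n → ℝ) 0 0 :=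
  ⟨[], fun A => by simp, by simp, by simp⟩

theorem AddsWithin.mono {M : Fin n → Fin n → ℝ} {a l a' l' : ℕ} (h : AddsWithin M a l)
    (ha : a ≤ a') (hl : l ≤ l') : AddsWithin M a' l' := by
  obtain ⟨ops, h1, h2, h3⟩ := h
  exact ⟨ops, h1, h2.trans ha, h3.trans hl⟩

theorem AddsWithin.add {M M' : Fin n → Fin n → ℝ} {a l a' l' : ℕ} (h : AddsWithin M a l)
    (h' : AddsWithin M' a' l') : AddsWithin (M + M') (a + a') (l + l') := by
  obtain ⟨ops, h1, h2, h3⟩ := h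
  obtain ⟨ops', h1', h2', h3'⟩ := h'
  refine ⟨ops ++ ops', fun A => ?_, ?_, ?_⟩
  · rw [List.foldl_append, h1, h1', add_assoc]
  · rw [List.countP_append]; exact add_le_add h2 h2'
  · rw [List.length_append]; exact add_le_add h3 h3'

theorem AddsWithin.sum {ι : Type*} (s : Finset ι) {M : ι → Fin n → Fin n → ℝ} {a l : ℕ}
    (h : ∀ i ∈ s, AddsWithin (M i) a l) :
    AddsWithin (∑ i ∈ s, M i) (s.card * a) (s.card * l) := by
  classical
  induction s using Finset.induction_on with
  | empty => simpa using addsWithin_zero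
  | insert i s hi ih =>
    rw [Finset.sum_insert hi, Finset.card_insert_of_notMem hi, add_comm s.card, add_mul, add_mul,
      one_mul, one_mul]
    exact (h i (Finset.mem_insert_self i s)).add
      (ih fun j hj => h j (Finset.mem_insert_of_mem hj))

/-- Flipping a set of ions and flipping it back. -/
theorem exists_flips (F : Finset (Fin n)) : ∃ pre post : List (IonOp n),
    (∀ A, pre.foldl step ⟨∅, A⟩ = ⟨F, A⟩) ∧ (∀ A, post.foldl step ⟨F, A⟩ = ⟨∅, A⟩) ∧
    pre.countP isPulse = 0 ∧ post.countP isPulse = 0 ∧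
    pre.length = F.card ∧ post.length = F.card := by
  induction F using Finset.induction_on with
  | empty => exact ⟨[], [], by simp⟩
  | insert v F hv ih =>
    obtain ⟨pre, post, h1, h2, h3, h4, h5, h6⟩ := ih
    refine ⟨pre ++ [flip v], flip v :: post, fun A => ?_, fun A => ?_, ?_, ?_, ?_, ?_⟩
    · simp [List.foldl_append, h1, step, hv]
    · simp [step, h2, hv]
    · simp [List.countP_append, h3, isPulse]
    · simp [h4, isPulse]
    · simp [h5, hv]
    · simp [h6, hv]

/-- Flip `F`, pulse for time `|c|` with the sign of `c`, flip back. Pulses have positive length, so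
`c = 0` uses the empty sequence. -/
theorem addsWithin_pulse (F : Finset (Fin n)) (c : ℝ) :
    AddsWithin (fun a b => c * (flipSign F a * flipSign F b)) 1 (2 * F.card + 1) := by
  rcases eq_or_ne c 0 with rfl | hc
  · convert (addsWithin_zero (n := n)).mono (Nat.zero_le 1) (Nat.zero_le (2 * F.card + 1)) using 1
    funext a b
    simp
  obtain ⟨pre, post, h1, h2, h3, h4, h5, h6⟩ := exists_flips F
  have hs : (if decide (0 < c) = true then (1 : ℝ) else -1) * |c| = c := by
    rcases lt_or_gt_of_ne hc with h0 | h0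
    · simp [not_lt.2 h0.le, abs_of_neg h0]
    · simp [h0, abs_of_pos h0]
  refine ⟨pre ++ pulse (decide (0 < c)) |c| (abs_pos.2 hc) :: post, fun A => ?_, ?_, ?_⟩
  · rw [List.foldl_append, h1, List.foldl_cons, step, h2]
    congr 1
    funext a b
    simp only [Pi.add_apply]
    rw [mul_left_comm, hs, mul_comm c, flipSign, flipSign]
    congr 2
    by_cases ha : a ∈ F <;> by_cases hb : b ∈ F <;> simp [ha, hb]
  · simp [List.countP_append, List.countP_cons, h3, h4, isPulse]
  · simp only [List.length_append, List.length_cons, h5, h6]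
    omega

/-- A star is a combination of four pulses. -/
theorem addsWithin_star {v : Fin n} {L : Finset (Fin n)} (hv : v ∉ L) (c : ℝ) :
    AddsWithin (fun a b => (if a = v ∧ b ∈ L then c else 0) + (if b = v ∧ a ∈ L then c else 0))
      4 (8 + 4 * L.card) := by
  -- The signs for `∅`, `{v}`, `L`, `insert v L`, weighted `1, -1, -1, 1`, add up to `4` on the
  -- pairs of `v` with a leaf and cancel on all others.
  have h := (((addsWithin_pulse ∅ (c / 4)).add (addsWithin_pulse {v} (-(c / 4)))).add
    (addsWithin_pulse L (-(c / 4)))).add (addsWithin_pulse (insert v L) (c / 4))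
  have hcard := Finset.card_insert_of_notMem hv
  refine (?_ : AddsWithin _ _ _).mono le_rfl
    (show (2 * (∅ : Finset (Fin n)).card + 1) + (2 * ({v} : Finset (Fin n)).card + 1) +
      (2 * L.card + 1) + (2 * (insert v L).card + 1) ≤ 8 + 4 * L.card by
        rw [hcard, Finset.card_empty, Finset.card_singleton]; omega)
  convert h using 1
  funext a b
  simp only [Pi.add_apply, flipSign, Finset.mem_insert, Finset.mem_singleton,
    Finset.notMem_empty, if_false]
  by_cases h1 : a = v <;> by_cases h2 : b = v <;> by_cases h3 : a ∈ L <;> by_cases h4 : b ∈ L <;>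
    simp_all <;> ring

end IonOp

namespace WGraph

open IonOp

variable {n : ℕ}

theorem bounds_of_addsWithin {G : WGraph n} {M : Fin n → Fin n → ℝ} {a l : ℕ}
    (h : AddsWithin M a l) (hM : ∀ u v, u ≠ v → M u v = G.cost s(u, v)) :
    G.pulseNumber ≤ a ∧ G.totalOpsNumber ≤ l := by
  obtain ⟨ops, h1, h2, h3⟩ := h
  have hc : Compiles ops G := by
    have hr : run ops = ⟨∅, 0 + M⟩ := h1 0
    refine ⟨by rw [hr], fun u v huv => ?_⟩
    rw [hr, ← hM u v huv]
    simp
  have hmem : ops ∈ {ops : List (IonOp n) | Compiles ops G} := hc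
  exact ⟨(Nat.sInf_le (Set.mem_image_of_mem (fun ops => ops.countP isPulse) hmem)).trans h2,
    (Nat.sInf_le (Set.mem_image_of_mem List.length hmem)).trans h3⟩

/-- A sum of `k` unweighted graphs needs at most `4 * n * k` pulses. -/
theorem pulseNumber_weightedSum_le (k : ℕ) (α : ℕ → ℝ) (F : ℕ → SimpleGraph (Fin n)) :
    (weightedSum k α F).pulseNumber ≤ k * (n * 4) := by
  classical
  -- Each vertex is the centre of the star to its larger neighbours, so every edge lies in exactly
  -- one star.
  have h1 : ∀ j ∈ Finset.Icc 1 k, AddsWithin (∑ v : Fin n, fun a b =>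
      (if a = v ∧ b ∈ Finset.univ.filter (fun w => v < w ∧ (F j).Adj v w) then α j else 0) +
      (if b = v ∧ a ∈ Finset.univ.filter (fun w => v < w ∧ (F j).Adj v w) then α j else 0))
      (n * 4) (n * (8 + 4 * n)) := fun j _ => by
    have h2 := AddsWithin.sum Finset.univ fun (v : Fin n) _ =>
      (addsWithin_star (v := v) (L := Finset.univ.filter (fun w => v < w ∧ (F j).Adj v w))
        (by simp) (α j)).mono le_rfl
          (Nat.add_le_add_left (Nat.mul_le_mul_left 4 (card_finset_fin_le _)) 8)
    rwa [Finset.card_univ, Fintype.card_fin] at h2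
  have h2 := AddsWithin.sum _ h1
  rw [Nat.card_Icc, Nat.add_sub_cancel] at h2
  refine (bounds_of_addsWithin h2 fun u v huv => ?_).1
  simp only [Finset.sum_apply, Finset.mem_filter, Finset.mem_univ, true_and]
  refine Finset.sum_congr rfl fun j _ => ?_
  simp only [Finset.sum_add_distrib, ite_and, Finset.sum_ite_eq, Finset.mem_univ, if_true,
    SimpleGraph.mem_edgeSet]
  rcases lt_or_gt_of_ne huv with h | h
  · simp [h, h.not_gt]
  · simp [h, h.not_gt, (F j).adj_comm u v]

/-- Compiling edge by edge takes at most `12` operations for every edge. -/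
theorem totalOpsNumber_le {G : WGraph n} (s : Finset (Sym2 (Fin n)))
    (hs : ∀ e, G.cost e ≠ 0 → e ∈ s) : G.totalOpsNumber ≤ s.card * 12 := by
  classical
  have h1 : ∀ e ∈ s, AddsWithin (fun a b => if s(a, b) = e then G.cost e else 0) 4 12 := by
    intro e _
    induction e using Sym2.ind with
    | _ u v =>
      rcases eq_or_ne u v with rfl | huv
      · convert (addsWithin_zero (n := n)).mono (Nat.zero_le 4) (Nat.zero_le 12) using 1
        funext a b
        simp [cost_diag]
      · have h := addsWithin_star (v := u) (L := {v}) (by simpa using huv) (G.cost s(u, v))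
        rw [Finset.card_singleton] at h
        convert h using 1
        funext a b
        simp only [Finset.mem_singleton, Sym2.eq_iff]
        by_cases h1 : a = u <;> by_cases h2 : b = v <;> by_cases h3 : a = v <;>
          by_cases h4 : b = u <;> simp_all
  refine (bounds_of_addsWithin (AddsWithin.sum s h1) fun u v _ => ?_).2
  simp only [Finset.sum_apply, Finset.sum_ite_eq]
  split_ifs with h
  · rfl
  · by_contra h2
    exact h (hs _ fun h3 => h2 h3.symm)

end WGraph

/-! ### The algorithm -/

theorem toOuterMeasure_iidDist {α : Type*} [Fintype α] (P : PMF α) {q : ℕ} (B : Set (Fin q → α)) :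
    (WGraph.iidDist P q).toOuterMeasure B =
      ENNReal.ofReal (iidProb (fun a => (P a).toReal) B) := by
  classical
  have h0 : ∀ ω : Fin q → α, 0 ≤ ∏ t, (P (ω t)).toReal := fun ω =>
    Finset.prod_nonneg fun t _ => ENNReal.toReal_nonneg
  have h1 : ∀ ω ∈ Finset.univ, 0 ≤ B.indicator (fun ω => ∏ t, (P (ω t)).toReal) ω := fun ω _ =>
    Set.indicator_apply_nonneg fun _ => h0 ω
  rw [PMF.toOuterMeasure_apply_fintype, iidProb, ENNReal.ofReal_sum_of_nonneg h1]
  refine Finset.sum_congr rfl fun ω _ => ?_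
  by_cases h : ω ∈ B
  · rw [Set.indicator_of_mem h, Set.indicator_of_mem h, WGraph.iidDist, PMF.ofFintype_apply,
      ENNReal.ofReal_prod_of_nonneg fun t _ => ENNReal.toReal_nonneg]
    exact Finset.prod_congr rfl fun t _ => (ENNReal.ofReal_toReal (P.apply_ne_top _)).symm
  · rw [Set.indicator_of_notMem h, Set.indicator_of_notMem h, ENNReal.ofReal_zero]

namespace WGraph

variable {n : ℕ}

theorem nonneg_sampledGraph {G : WGraph n} (hG : G.Nonneg) (P : PMF (Sym2 (Fin n))) {q : ℕ}
    (ω : Fin q → Sym2 (Fin n)) : (G.sampledGraph P ω).Nonneg := fun e => by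
  simp only [sampledGraph]
  refine Finset.sum_nonneg fun t _ => ?_
  split_ifs
  · exact div_nonneg (hG e) (by positivity)
  · exact le_rfl

theorem cut_sampledGraph (G : WGraph n) (P : PMF (Sym2 (Fin n))) {q : ℕ}
    (ω : Fin q → Sym2 (Fin n)) (S : Finset (Fin n)) : (G.sampledGraph P ω).cut S =
      ∑ t, crossInd S (ω t) * (G.cost (ω t) / (q * (P (ω t)).toReal)) := by
  classical
  rw [cut_eq_sum]
  simp only [sampledGraph, Finset.mul_sum]
  rw [Finset.sum_comm]
  refine Finset.sum_congr rfl fun t _ => ?_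
  simp only [mul_ite, mul_zero, Finset.sum_ite_eq, Finset.mem_univ, if_true]

theorem mem_range_of_sampledGraph_cost_ne_zero {G : WGraph n} {P : PMF (Sym2 (Fin n))} {q : ℕ}
    {ω : Fin q → Sym2 (Fin n)} {e : Sym2 (Fin n)} (h : (G.sampledGraph P ω).cost e ≠ 0) :
    ∃ t, ω t = e := by
  classical
  by_contra! hne
  refine h ?_
  simp only [sampledGraph]
  exact Finset.sum_eq_zero fun t _ => if_neg (hne t)

theorem totalCost_pos_iff {G : WGraph n} (hG : G.Nonneg) :
    0 < G.totalCost ↔ ∃ e, 0 < G.cost e := by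
  rw [totalCost, Finset.sum_pos_iff_of_nonneg fun e _ => hG e]
  simp

theorem totalCost_pos_of_tsum_leverage {G : WGraph n} (hG : G.Nonneg)
    (h : ∑' e, G.leverage e ≠ 0) : 0 < G.totalCost := by
  rw [totalCost_pos_iff hG]
  by_contra! hne
  refine h ?_
  rw [tsum_leverage hG, Finset.sum_eq_zero fun e _ => by
    rw [le_antisymm (hne e) (hG e), zero_mul], ENNReal.ofReal_zero]

/-! ### Numerical bounds in `n` and `ε`. -/

theorem log_le_log_div (hn : 2 ≤ n) {ε : ℝ} (hε : 0 < ε) (hε1 : ε < 1) :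
    Real.log n ≤ Real.log (n / ε) := by
  have hn0 : (0 : ℝ) < n := by positivity
  exact Real.log_le_log hn0 (le_div_self hn0.le hε hε1.le)

theorem half_le_log (hn : 2 ≤ n) : 1 / 2 ≤ Real.log n := by
  have h1 : Real.log 2 ≤ Real.log n := Real.log_le_log two_pos (by exact_mod_cast hn)
  linarith [Real.log_two_gt_d9]

theorem pulseNumber_binaryDecompose_le (H : WGraph n) (hn : 2 ≤ n) {ε : ℝ} (hε : 0 < ε)
    (hε1 : ε < 1) :
    ((H.binaryDecompose (ε / 3)).pulseNumber : ℝ) ≤ 40 * (n * Real.log (n / ε)) := by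
  have hn0 : (0 : ℝ) < n := by positivity
  have hn2 : (2 : ℝ) ≤ n := by exact_mod_cast hn
  have h1 : ((H.binaryDecompose (ε / 3)).pulseNumber : ℝ) ≤
      (1 + ⌊Real.logb 2 ((n : ℝ) ^ 2 / (ε / 3))⌋₊ : ℕ) * (n * 4) := by
    have h : (H.binaryDecompose (ε / 3)).pulseNumber ≤ _ := pulseNumber_weightedSum_le _ _ _
    refine (Nat.cast_le.2 h).trans_eq ?_
    push_cast
    rfl
  have hl : 1 / 2 ≤ Real.log (n / ε) := (half_le_log hn).trans (log_le_log_div hn hε hε1)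
  have h2 : Real.logb 2 ((n : ℝ) ^ 2 / (ε / 3)) ≤ 8 * Real.log (n / ε) := by
    -- Together with `log 2 > 1 / 2`, the fourth power gives the factor `8`. The extra layer is
    -- absorbed into `10` since the logarithm is at least `1 / 2`, and four pulses per star give
    -- `40`.
    have h3 : (n : ℝ) ^ 2 / (ε / 3) ≤ (n / ε) ^ 4 := by
      rw [div_pow, div_le_div_iff₀ (by positivity) (by positivity)]
      have h4 : ε ^ 4 ≤ ε := by
        calc ε ^ 4 ≤ ε ^ 1 := pow_le_pow_of_le_one hε.le hε1.le (by norm_num)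
          _ = ε := pow_one ε
      have h5 : (4 : ℝ) ≤ n ^ 2 := by nlinarith
      calc (n : ℝ) ^ 2 * ε ^ 4 ≤ n ^ 2 * ε := by gcongr
        _ ≤ n ^ 2 * (n ^ 2 * (ε / 3)) := by gcongr; nlinarith
        _ = _ := by ring
    have h6 := Real.log_le_log (by positivity) h3
    rw [Real.log_pow] at h6
    push_cast at h6
    rw [Real.logb, div_le_iff₀ (Real.log_pos one_lt_two)]
    nlinarith [Real.log_two_gt_d9]
  have h3 : (⌊Real.logb 2 ((n : ℝ) ^ 2 / (ε / 3))⌋₊ : ℝ) ≤ 8 * Real.log (n / ε) :=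
    (Nat.floor_le_floor h2 |> fun h => (Nat.cast_le (α := ℝ)).2 h).trans
      (Nat.floor_le (by linarith))
  push_cast at h1
  calc _ ≤ _ := h1
    _ ≤ (10 * Real.log (n / ε)) * (n * 4) := by gcongr; linarith
    _ = _ := by ring

theorem ceil_samples_le (hn : 2 ≤ n) {ε C₀ : ℝ} (hε : 0 < ε) (hε1 : ε < 1) (hC₀ : 0 < C₀) :
    (⌈C₀ * n * Real.log n / (ε / 3) ^ 2⌉₊ : ℝ) ≤
      (9 * C₀ + 1) * (n * Real.log (n / ε) / ε ^ 2) := by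
  have hn0 : (0 : ℝ) < n := by positivity
  have hn2 : (2 : ℝ) ≤ n := by exact_mod_cast hn
  have hl := half_le_log hn
  have hl' := log_le_log_div hn hε hε1
  refine (Nat.ceil_lt_add_one (by positivity)).le.trans ?_
  have h1 : C₀ * n * Real.log n / (ε / 3) ^ 2 ≤ 9 * C₀ * (n * Real.log (n / ε) / ε ^ 2) := by
    calc _ = 9 * C₀ * (n * Real.log n / ε ^ 2) := by field_simp; norm_num
      _ ≤ _ := by gcongr
  -- Absorbs the `1` lost in rounding up.
  have h2 : 1 ≤ n * Real.log (n / ε) / ε ^ 2 := by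
    rw [le_div_iff₀ (by positivity)]
    have h3 : ε ^ 2 ≤ 1 := pow_le_one₀ hε.le hε1.le
    nlinarith
  linarith

/-- The properties of the output that the theorem asserts. -/
def IsGoodOutput (G : WGraph n) (C ε : ℝ) (G' : WGraph n) : Prop :=
  G'.Nonneg ∧
  (∀ S : Finset (Fin n), G.totalCost / 2 ≤ G.cut S →
    (1 - ε) * G.cut S ≤ G'.cut S ∧ G'.cut S ≤ (1 + ε) * G.cut S) ∧
  (∀ S : Finset (Fin n), G'.IsMaxCut S → ∀ T : Finset (Fin n),
    (1 - ε) * G.cut T ≤ G.cut S) ∧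
  (G'.pulseNumber : ℝ) ≤ C * (n * Real.log (n / ε)) ∧
  (G'.totalOpsNumber : ℝ) ≤ C * (n * Real.log (n / ε) / ε ^ 2)

/-- The constant in the bounds on the numbers of operations. -/
noncomputable def opsConst (C₀ : ℝ) : ℝ := 40 + 12 * (9 * C₀ + 1)

theorem isGoodOutput_bestDecompose {G H : WGraph n} (hG : G.Nonneg) (hH : H.Nonneg) (hn : 2 ≤ n)
    {ε C₀ : ℝ} (hε : 0 < ε) (hε1 : ε < 1) (hC₀ : 0 < C₀)
    (hGH : ∀ S, |H.cut S - G.cut S| ≤ ε / 100 * G.totalCost)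
    (s : Finset (Sym2 (Fin n))) (hs : ∀ e, H.cost e ≠ 0 → e ∈ s)
    (hcard : s.card ≤ ⌈C₀ * n * Real.log n / (ε / 3) ^ 2⌉₊) :
    G.IsGoodOutput (opsConst C₀) ε (H.bestDecompose (ε / 3)) := by
  have hr := isRounding_bestDecompose hH (ε := ε / 3) (by positivity)
  obtain ⟨h1, h2⟩ := hr.cut_bounds hG hH hε hε1 hGH
  have hlog : 0 ≤ Real.log (n / ε) := by
    linarith [half_le_log hn, log_le_log_div hn hε hε1]
  refine ⟨fun e => (hr e).1, h1, h2, ?_, ?_⟩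
  · calc ((H.bestDecompose (ε / 3)).pulseNumber : ℝ)
        ≤ (H.binaryDecompose (ε / 3)).pulseNumber := by
          exact_mod_cast pulseNumber_bestDecompose_le H _
      _ ≤ 40 * (n * Real.log (n / ε)) := pulseNumber_binaryDecompose_le H hn hε hε1
      _ ≤ _ := by
          gcongr
          rw [opsConst]
          linarith
  -- A rounding is squeezed between `0` and the cost in `H`, so it has no edges outside the sampled
  -- ones.
  · have h3 := totalOpsNumber_le (G := H.bestDecompose (ε / 3)) s fun e he => hs e fun h0 => he
      (le_antisymm (h0 ▸ (hr e).2.1) (hr e).1)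
    calc ((H.bestDecompose (ε / 3)).totalOpsNumber : ℝ) ≤ s.card * 12 := by exact_mod_cast h3
      _ ≤ (9 * C₀ + 1) * (n * Real.log (n / ε) / ε ^ 2) * 12 := by
          gcongr
          exact (Nat.cast_le.2 hcard).trans (ceil_samples_le hn hε hε1 hC₀)
      _ = 12 * (9 * C₀ + 1) * (n * Real.log (n / ε) / ε ^ 2) := by ring
      _ ≤ _ := by
          gcongr
          rw [opsConst]
          linarith

theorem le_sparseUnionOfStars {G : WGraph n} (hG : G.Nonneg) (hn : 2 ≤ n) {ε C₀ : ℝ}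
    (hε : 0 < ε) (hε1 : ε < 1) (hC₀ : 1100000 ≤ C₀) :
    ENNReal.ofReal (1 - 10 / n) ≤ (G.sparseUnionOfStars C₀ (ε / 3) (ε / 3)).toOuterMeasure
      {G' | G.IsGoodOutput (opsConst C₀) ε G'} := by
  classical
  have hC₀' : 0 < C₀ := by linarith
  rw [sparseUnionOfStars, PMF.toOuterMeasure_map_apply, sparsify]
  split_ifs with h
  · set q := ⌈C₀ * n * Real.log n / (ε / 3) ^ 2⌉₊ with hq
    set P := G.edgeDist h with hP
    rw [PMF.toOuterMeasure_map_apply, toOuterMeasure_iidDist]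
    refine ENNReal.ofReal_le_ofReal ?_
    have hp0 : ∀ e, 0 ≤ (P e).toReal := fun e => ENNReal.toReal_nonneg
    have hp1 : ∑ e, (P e).toReal = 1 := by
      rw [← ENNReal.toReal_sum fun e _ => P.apply_ne_top e, ← tsum_fintype (L := .unconditional _),
        P.tsum_coe, ENNReal.toReal_one]
    have hlog : 0 ≤ Real.log n := Real.log_natCast_nonneg n
    -- `γ = ε / 400` makes the cut error `4 * γ = ε / 100`. With the `9` from `(ε / 3) ^ 2` this
    -- requires `9 * C₀ / 160000 ≥ 60`, the origin of the threshold `1100000`.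
    have hbound : 60 * (n * Real.log n) ≤ (ε / 400) ^ 2 * q := by
      have h1 := Nat.le_ceil (C₀ * n * Real.log n / (ε / 3) ^ 2)
      calc 60 * (n * Real.log n) ≤ 9 * C₀ / 160000 * (n * Real.log n) := by
            gcongr
            linarith
        _ = (ε / 400) ^ 2 * (C₀ * n * Real.log n / (ε / 3) ^ 2) := by field_simp; ring
        _ ≤ _ := by gcongr
    have hbad := iidProb_cut_error_le hG (totalCost_pos_of_tsum_leverage hG h) hn hp0 hp1
      (cost_le_edgeDist hG h) (q := q) (γ := ε / 400) (by positivity) (by linarith) hbound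
    have hcompl := iidProb_compl hp1 {ω : Fin q → Sym2 (Fin n) | ∃ S, 4 * (ε / 400) *
      G.totalCost < |∑ t, crossInd S (ω t) * (G.cost (ω t) / (q * (P (ω t)).toReal)) - G.cut S|}
    refine (show 1 - 10 / (n : ℝ) ≤ _ by rw [hcompl]; linarith).trans (iidProb_mono hp0 ?_)
    intro ω hω
    simp only [Set.mem_compl_iff, Set.mem_ofPred_eq, not_exists, not_lt] at hω
    refine isGoodOutput_bestDecompose hG (nonneg_sampledGraph hG P ω) hn hε hε1 hC₀'
      (fun S => ?_) (Finset.univ.image ω) (fun e he => ?_) ?_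
    · rw [cut_sampledGraph]
      refine (hω S).trans_eq ?_
      ring
    · obtain ⟨t, rfl⟩ := mem_range_of_sampledGraph_cost_ne_zero he
      exact Finset.mem_image_of_mem ω (Finset.mem_univ t)
    · exact Finset.card_image_le.trans_eq (by rw [Finset.card_univ, Fintype.card_fin])
  · have hzero : ∀ e, G.cost e = 0 := fun e => by
      by_contra hne
      exact h (tsum_leverage_ne_zero hG ((hG e).lt_of_ne' hne))
    rw [PMF.toOuterMeasure_pure_apply, if_pos]
    · rw [← ENNReal.ofReal_one]
      refine ENNReal.ofReal_le_ofReal ?_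
      have : (0 : ℝ) ≤ 10 / n := by positivity
      linarith
    · refine isGoodOutput_bestDecompose hG (fun e => le_rfl) hn hε hε1 hC₀' (fun S => ?_) ∅
        (fun e he => absurd rfl he) (Nat.zero_le _)
      simp [cut, totalCost, hzero, edgeless]

end WGraph

theorem mainTheorem3 :
    ∃ K : ℝ, 0 < K ∧ ∀ C₀ : ℝ, K ≤ C₀ →
      ∃ C : ℝ, 0 < C ∧ ∃ p : ℕ → ℝ, Filter.Tendsto p Filter.atTop (nhds 1) ∧
        ∀ (n : ℕ) (G : WGraph n) (ε : ℝ), G.graph.Connected → G.Nonneg → 0 < ε → ε < 1 →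
          ENNReal.ofReal (p n) ≤
            (G.sparseUnionOfStars C₀ (ε / 3) (ε / 3)).toOuterMeasure {G' : WGraph n |
              G'.Nonneg ∧
              (∀ S : Finset (Fin n), G.totalCost / 2 ≤ G.cut S →
                (1 - ε) * G.cut S ≤ G'.cut S ∧ G'.cut S ≤ (1 + ε) * G.cut S) ∧
              (∀ S : Finset (Fin n), G'.IsMaxCut S → ∀ T : Finset (Fin n),
                (1 - ε) * G.cut T ≤ G.cut S) ∧
              (G'.pulseNumber : ℝ) ≤ C * (n * Real.log (n / ε)) ∧
              (G'.totalOpsNumber : ℝ) ≤ C * (n * Real.log (n / ε) / ε ^ 2)} := by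
  refine ⟨1100000, by norm_num, fun C₀ hC₀ => ⟨WGraph.opsConst C₀, ?_, fun n => 1 - 10 / n, ?_, ?_⟩⟩
  · rw [WGraph.opsConst]
    linarith
  · have h := (tendsto_const_div_atTop_nhds_zero_nat (10 : ℝ)).const_sub 1
    rwa [sub_zero] at h
  · intro n G ε hconn hG hε hε1
    -- Connectivity excludes `n = 0`, where `10 / 0 = 0` would make the claimed probability `1`. For
    -- `n = 1` the claimed probability is negative.
    rcases Nat.lt_or_ge n 2 with hn | hn
    · have hn1 : n = 1 := by
        obtain ⟨v⟩ := hconn.nonempty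
        have := v.pos
        omega
      subst hn1
      rw [ENNReal.ofReal_of_nonpos (by norm_num)]
      exact zero_le
    · exact WGraph.le_sparseUnionOfStars hG hn hε hε1 hC₀
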